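/- Let $\mathbb R_+=[0,\infty)$. For a non-zero convex function $G\colon\mathbb R_+\to\mathbb R_+$ with $G(0)=0$, the $d$-dimensional Orlicz norm $\|\cdot\|_G$ is the norm on $\mathbb R^d$ with unit ball $\{x : \sum_{i=1}^d G(|x_i|)\le 1\}$. For $1\le k\le d$, the top-$k$ norm of $x\in\mathbb R^d$ is the sum of the $k$ largest absolute values of its coordinates. A randomized data structure for approximate near neighbor search (ANN) over a norm $\|\cdot\|$ on $\mathbb R^d$, for $n$-point datasets, with threshold $r>0$ and approximation $c$, preprocesses the points $p_1,\dots,p_n\in\mathbb R^d$ into random memory contents. For every fixed query $q\in\mathbb R^d$ with $\min_i\|p_i-q\|\le r$, with probability at least $99/100$ over the preprocessing, the query algorithm outputs an index $j$ with $\|p_j-q\|\le c\,r$. Space is the number of memory cells. Query time is the number of steps of the query algorithm in the worst case over all queries and all outcomes of the randomness. Queries run on a real RAM with unit-cost arithmetic and comparisons. Cells hold reals or integer words. Words have just enough bits to address the memory, and reals are never rounded to words. **Theorem.** There are an absolute constant $C$ and a single query program such that for every $\varepsilon\in(0,1/2)$ there is a constant $K_\varepsilon$, depending only on $\varepsilon$,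 for which the following holds. For all $d,n\ge 1$, all $r>0$ and every $d$-dimensional Orlicz norm $\|\cdot\|_G$, that program is the query algorithm of a randomized data structure for ANN over $\|\cdot\|_G$ for $n$-point datasets with threshold $r$, $$\text{approximation } C\,\frac{\max(1,\log\log d)}{\varepsilon^2},\qquad \text{space at most } C\,d\,n^{1+\varepsilon},\qquad \text{query time at most } K_\varepsilon\,d\,n^{\varepsilon}.$$ (For $d=1$, $\max(1,\log\log d)$ is read as $1$.) The same statement holds, with its own constants and program, for every top-$k$ norm on $\mathbb R^d$, $1\le k\le d$. In particular, for fixed $\varepsilon$ the approximation for top-$k$ norms is $O(\log\log d)$. -/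

import Mathlib

open MeasureTheory
open scoped NNReal

/-! ### Norms -/

/-- An Orlicz function: a non-zero convex `G : ℝ₊ → ℝ₊` with `G 0 = 0`. -/
structure IsOrliczFunction (G : ℝ≥0 → ℝ≥0) : Prop where
  convex : ConvexOn ℝ≥0 Set.univ G
  map_zero : G 0 = 0
  nonzero : ∃ t, G t ≠ 0

/-- The Orlicz norm `‖·‖_G` on `ℝ^d`: the norm (Minkowski functional) whose unit ball is
`{x | ∑ i, G |x i| ≤ 1}`. -/
noncomputable def orliczNorm (G : ℝ≥0 → ℝ≥0) {d : ℕ} (x : Fin d → ℝ) : ℝ :=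
  gauge {y : Fin d → ℝ | ∑ i, G ‖y i‖₊ ≤ 1} x

/-- The vector `x^*`: the absolute values of the coordinates of `x`, in non-increasing order. -/
noncomputable def sortedAbs {d : ℕ} (x : Fin d → ℝ) : Fin d → ℝ :=
  fun i => |x (Tuple.sort (fun j => -|x j|) i)|

/-- The top-`k` norm: the sum of the `k` largest absolute values of coordinates. -/
noncomputable def topNorm (k : ℕ) {d : ℕ} (x : Fin d → ℝ) : ℝ :=
  ∑ i with i.val < k, sortedAbs x i

/-! ### The real RAM

The memory consists of a bank of `s + 1` cells holding words and a bank of `s + 1` cells holding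
real numbers. A word is a number in `{0, …, s}`, i.e. it has just enough bits to address the
memory, and word arithmetic is modulo `s + 1`. A program is a finite list of instructions; it
uses finitely many word registers and real registers. The query point is a read-only input.
Every instruction costs one time step. There is no rounding of reals to words. -/

/-- The word operations (division is integer division). -/
inductive WordOp
  | add | sub | mul | div

/-- The real operations. -/
inductive RealOp
  | add | sub | mul | div

/-- The instructions. Below `W i` is the `i`-th word register, `R i` the `i`-th real register. -/
inductive Instr
  /-- `W i := v` -/
  | wordConst (i v : ℕ)
  /-- `W i := W j op W k` -/
  | wordOp (op : WordOp) (i j k : ℕ)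
  /-- `W i := wordCell[W j]` -/
  | wordLoad (i j : ℕ)
  /-- `wordCell[W j] := W i` -/
  | wordStore (i j : ℕ)
  /-- `R i := v` -/
  | realConst (i : ℕ) (v : ℤ)
  /-- `R i := R j op R k` -/
  | realOp (op : RealOp) (i j k : ℕ)
  /-- `R i := realCell[W j]` -/
  | realLoad (i j : ℕ)
  /-- `realCell[W j] := R i` -/
  | realStore (i j : ℕ)
  /-- `R i := q[W j]`, the coordinate of the query point with number `W j` -/
  | queryLoad (i j : ℕ)
  /-- if `W i ≤ W j`, go to the instruction number `l` -/
  | wordJump (i j l : ℕ)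
  /-- if `R i ≤ R j`, go to the instruction number `l` -/
  | realJump (i j l : ℕ)
  /-- halt with output `W i` -/
  | halt (i : ℕ)

/-- Memory contents: `s + 1` word cells and `s + 1` real cells. -/
structure Memory (s : ℕ) where
  wordCell : Fin (s + 1) → Fin (s + 1)
  realCell : Fin (s + 1) → ℝ

/-- A configuration of the machine. -/
structure Config (s : ℕ) where
  /-- number of the next instruction -/
  pc : ℕ
  W : ℕ → Fin (s + 1)
  R : ℕ → ℝ
  mem : Memory s
  /-- `some w` once the machine has halted with output `w` -/
  out : Option (Fin (s + 1))

def WordOp.eval {s : ℕ} : WordOp → Fin (s + 1) → Fin (s + 1) → Fin (s + 1)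
  | .add, a, b => a + b
  | .sub, a, b => a - b
  | .mul, a, b => a * b
  | .div, a, b => a / b

noncomputable def RealOp.eval : RealOp → ℝ → ℝ → ℝ
  | .add, a, b => a + b
  | .sub, a, b => a - b
  | .mul, a, b => a * b
  | .div, a, b => a / b

/-- The effect of one instruction on a configuration, for the query point `q`. -/
noncomputable def Instr.exec {s d : ℕ} (q : Fin d → ℝ) (c : Config s) : Instr → Config s
  | .wordConst i v =>
      { c with pc := c.pc + 1, W := Function.update c.W i (Fin.ofNat (s + 1) v) }
  | .wordOp op i j k =>
      { c with pc := c.pc + 1, W := Function.update c.W i (op.eval (c.W j) (c.W k)) }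
  | .wordLoad i j =>
      { c with pc := c.pc + 1, W := Function.update c.W i (c.mem.wordCell (c.W j)) }
  | .wordStore i j =>
      { c with
        pc := c.pc + 1
        mem := { c.mem with wordCell := Function.update c.mem.wordCell (c.W j) (c.W i) } }
  | .realConst i v =>
      { c with pc := c.pc + 1, R := Function.update c.R i (v : ℝ) }
  | .realOp op i j k =>
      { c with pc := c.pc + 1, R := Function.update c.R i (op.eval (c.R j) (c.R k)) }
  | .realLoad i j =>
      { c with pc := c.pc + 1, R := Function.update c.R i (c.mem.realCell (c.W j)) }
  | .realStore i j =>
      { c with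
        pc := c.pc + 1
        mem := { c.mem with realCell := Function.update c.mem.realCell (c.W j) (c.R i) } }
  | .queryLoad i j =>
      { c with
        pc := c.pc + 1
        R := Function.update c.R i (if h : (c.W j).val < d then q ⟨(c.W j).val, h⟩ else 0) }
  | .wordJump i j l => { c with pc := if c.W i ≤ c.W j then l else c.pc + 1 }
  | .realJump i j l => { c with pc := if c.R i ≤ c.R j then l else c.pc + 1 }
  | .halt i => { c with out := some (c.W i) }

/-- One step of the program `prog`. A halted machine does not move any more; a machine whose
program counter is outside of the program is stuck (and never halts). -/
noncomputable def Config.step (prog : List Instr) {s d : ℕ} (q : Fin d → ℝ) (c : Config s) :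
    Config s :=
  match c.out, prog[c.pc]? with
  | none, some instr => instr.exec q c
  | _, _ => c

/-- The initial configuration on memory contents `m`: all registers are `0`. -/
def Memory.start {s : ℕ} (m : Memory s) : Config s :=
  { pc := 0, W := fun _ => 0, R := fun _ => 0, mem := m, out := none }

/-- The output of `prog` on memory contents `m` and query point `q`, if it halts within `t` steps;
otherwise `none`. -/
noncomputable def outputWithin (prog : List Instr) {s d : ℕ} (t : ℕ) (m : Memory s)
    (q : Fin d → ℝ) : Option (Fin (s + 1)) :=
  ((Config.step prog q)^[t] m.start).out

/-! ### Approximate near neighbors -/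

/-- `prog` is the query program of a randomized data structure for the approximate near neighbor
problem over `(ℝ^d, ν)` for `n`-point datasets, with distance threshold `r`, approximation `c`,
at most `space` memory cells and worst-case query time at most `time`.

Preprocessing turns the dataset `P` into random memory contents `M`. Whatever the outcome, every
query halts in time. For each query point `q` that has a data point within distance `r`, except
with probability at most `1/100` over the choice of `M`, the output is the index of a data point
within distance `c * r` from `q`. -/
def IsANNDataStructure (prog : List Instr) {d : ℕ} (ν : (Fin d → ℝ) → ℝ) (n : ℕ)
    (r c space time : ℝ) : Prop :=
  ∀ P : Fin n → Fin d → ℝ,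
    ∃ s t : ℕ, 2 * ((s : ℝ) + 1) ≤ space ∧ (t : ℝ) ≤ time ∧
      ∃ (Ω : Type) (_ : MeasurableSpace Ω) (μ : Measure Ω) (M : Ω → Memory s),
        IsProbabilityMeasure μ ∧
        (∀ ω, ∀ q : Fin d → ℝ, outputWithin prog t (M ω) q ≠ none) ∧
        ∀ q : Fin d → ℝ, (∃ i, ν (P i - q) ≤ r) →
          μ {ω | ¬ ∃ (w : Fin (s + 1)) (j : Fin n),
            outputWithin prog t (M ω) q = some w ∧ w.val = j.val ∧ ν (P j - q) ≤ c * r} ≤ 1 / 100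

/-!
A *comparison diagram* is a branching program whose nodes compare one coordinate of the query with a
stored threshold. The data structure is a random comparison diagram, and the query program
`queryProgram` is an interpreter for such diagrams (`outputWithin_diagramMemory`); it knows neither
the norm nor the parameters.

*Maximum norm.* For a set of `m` points and query radius `1`, either some coordinate and threshold
split the points (with those near the threshold going to both sides) such that the bound
`m ^ (1 + δ)` on the number of leaves survives and each side loses a fraction `1 / (4 * d)` of the
points, or some box of radius `O(l)`, where `(1 + δ) ^ l` is about `log d`, contains half of the
points (`exists_isGoodSplit_or_box`): without a good split the fraction of the points beyond the
median by `3 * k` shrinks doubly exponentially in `k`. In the first case the diagram compares and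
recurses on both sides; in the second case it answers the queries close to the box with any point of
the box, and recurses on the remaining points for the others. This gives a diagram of size
`O(d * m ^ (1 + δ))` and depth `O(d * log m)` with approximation `6 * l + 2`
(`exists_maxNormDiagram`). It works for every rescaling of the coordinates, and an answer it gives is
correct for the maximum norm even if there is no near point.

*Orlicz norms.* Let `u i` be independent with `{|x i| ≤ u i}` having probability about
`exp (-Λ * G |x i|)`. All coordinates satisfy `|x i| ≤ u i` with probability
`exp (-Λ * ∑ i, G |x i|)`, which is at least `exp (-Λ)` for `x` in the unit ball and at most
`exp (-Λ * B)` for `x` of norm at least `B`. With `Λ` about `ε / 2 * log n` and `B` about `6 / ε`,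
about `n ^ (ε / 2)` independent repetitions find a near point, while with high probability no far
point ever looks near, so that the first answer of a repetition can be given without knowledge of
`G`. A far point has to survive the approximation of the maximum norm, of order `log log d / ε`, so
that the approximations multiply to `O(log log d / ε ^ 2)`.

*Top-`k` norms* are within a factor `2` of the Orlicz norm of `t ↦ max (t - 1 / k) 0`.
-/

/-! ### Comparison diagrams and their evaluation on the real RAM -/

/-- A node of a comparison diagram for queries in `ℝ^d` and answers in `Fin n`: either it gives the
answer `j`, or it tests whether `q i ≤ t` and passes on to the node number `yes` or `no`. A diagram
is a list of such nodes; pointers are positions in the list. -/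
inductive CompNode (d n : ℕ)
  | halt (j : Fin n)
  | cmp (i : Fin d) (t : ℝ) (yes no : ℕ)

/-- `Reaches L q m a b`: on the query `q`, the diagram `L` gets from node `a` to node `b` by `m`
comparisons. -/
inductive Reaches {d n : ℕ} (L : List (CompNode d n)) (q : Fin d → ℝ) : ℕ → ℕ → ℕ → Prop
  | refl (a : ℕ) : Reaches L q 0 a a
  | step {m a b : ℕ} {i : Fin d} {t : ℝ} {y z : ℕ} (h : L[a]? = some (.cmp i t y z))
      (h' : Reaches L q m (if q i ≤ t then y else z) b) : Reaches L q (m + 1) a b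

theorem Reaches.trans {d n : ℕ} {L : List (CompNode d n)} {q : Fin d → ℝ} {m m' a b c : ℕ}
    (h : Reaches L q m a b) (h' : Reaches L q m' b c) : Reaches L q (m + m') a c := by
  induction h with
  | refl a => simpa using h'
  | step h _ ih => rw [Nat.add_right_comm]; exact .step h (ih h')

theorem getElem?_of_prefix {α : Type*} {L L' : List α} (hL : L <+: L') {a : ℕ} {x : α}
    (h : L[a]? = some x) : L'[a]? = some x := by
  obtain ⟨l, rfl⟩ := hL
  obtain ⟨ha, -⟩ := List.getElem?_eq_some_iff.1 h
  rw [List.getElem?_append_left ha, h]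

theorem Reaches.mono {d n : ℕ} {L L' : List (CompNode d n)} (hL : L <+: L') {q : Fin d → ℝ}
    {m a b : ℕ} (h : Reaches L q m a b) : Reaches L' q m a b := by
  induction h with
  | refl a => exact .refl a
  | step h _ ih => exact .step (getElem?_of_prefix hL h) ih

/-- The query program: word cell `0` holds the address of the entry node of a diagram. The node with
address `p` occupies the word cells `p` (`0` for `halt`, `1` for `cmp`), `p + 1` (answer or
coordinate), `p + 2` and `p + 3` (addresses of the two successors), and the real cell `p`
(threshold). Word register `5` is never written and stays `0`. -/
def queryProgram : List Instr :=
  [ .wordLoad 0 0,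
    .wordConst 1 1,
    .wordLoad 2 0,
    .wordOp .add 3 0 1,
    .wordLoad 4 3,
    .wordJump 2 5 13,
    .queryLoad 0 4,
    .realLoad 1 0,
    .wordOp .add 3 3 1,
    .realJump 0 1 11,
    .wordOp .add 3 3 1,
    .wordLoad 0 3,
    .wordJump 5 5 1,
    .halt 4 ]

/-- The `f`-th word of a node; node number `a` has the address `4 * a + 1`. -/
def CompNode.word {d n : ℕ} : CompNode d n → ℕ → ℕ
  | .halt j, f => if f = 1 then j else 0
  | .cmp i _ y z, f => if f = 0 then 1 else if f = 1 then i else if f = 2 then 4 * y + 1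
      else 4 * z + 1

/-- The threshold of a node, with `0` for nodes that have none. -/
def CompNode.threshold {d n : ℕ} : CompNode d n → ℝ
  | .halt _ => 0
  | .cmp _ t _ _ => t

/-- The memory contents that represent the diagram `L` with the entry node `e`. -/
noncomputable def diagramMemory {d n : ℕ} (s : ℕ) (L : List (CompNode d n)) (e : ℕ) : Memory s where
  wordCell x := Fin.ofNat (s + 1)
    (if x.val = 0 then 4 * e + 1 else
      (L[(x.val - 1) / 4]?.map fun nd => nd.word ((x.val - 1) % 4)).getD 0)
  realCell x := (L[(x.val - 1) / 4]?.map CompNode.threshold).getD 0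

theorem diagramMemory_wordCell {d n s : ℕ} {L : List (CompNode d n)} {e a : ℕ} {nd : CompNode d n}
    (h : L[a]? = some nd) {x : Fin (s + 1)} {f : ℕ} (hf : f < 4) (hx : x.val = 4 * a + 1 + f) :
    (diagramMemory s L e).wordCell x = Fin.ofNat (s + 1) (nd.word f) := by
  have h1 : (x.val - 1) / 4 = a := by omega
  have h2 : (x.val - 1) % 4 = f := by omega
  have h3 : x.val ≠ 0 := by omega
  simp only [diagramMemory, h1, h2, h3, h, if_false, Option.map_some, Option.getD_some]

theorem diagramMemory_realCell {d n s : ℕ} {L : List (CompNode d n)} {e a : ℕ} {nd : CompNode d n}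
    (h : L[a]? = some nd) {x : Fin (s + 1)} (hx : x.val = 4 * a + 1) :
    (diagramMemory s L e).realCell x = nd.threshold := by
  have h1 : (x.val - 1) / 4 = a := by omega
  simp only [diagramMemory, h1, h, Option.map_some, Option.getD_some]

theorem fin_val_add_one {s : ℕ} {x : Fin (s + 1)} {a : ℕ} (hx : x.val = a) (h : a + 1 ≤ s) :
    (x + Fin.ofNat (s + 1) 1).val = a + 1 := by
  rw [Fin.val_add, Fin.val_ofNat, hx, Nat.mod_eq_of_lt (a := 1) (by omega),
    Nat.mod_eq_of_lt (by omega)]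

theorem fin_val_ofNat {s a : ℕ} (h : a ≤ s) : (Fin.ofNat (s + 1) a).val = a := by
  rw [Fin.val_ofNat, Nat.mod_eq_of_lt (by omega)]

/-- One pass through the loop of the query program follows one edge of the diagram. -/
theorem iterate_step_cmp {d n s : ℕ} {L : List (CompNode d n)} {e : ℕ} (q : Fin d → ℝ)
    (hs : 4 * L.length ≤ s) (hd : d ≤ s) {a y z : ℕ} {i : Fin d} {t : ℝ}
    (h : L[a]? = some (.cmp i t y z)) (W : ℕ → Fin (s + 1)) (R : ℕ → ℝ)
    (h0 : W 0 = Fin.ofNat (s + 1) (4 * a + 1)) (h5 : W 5 = 0) :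
    ∃ T ≤ 12, ∃ W' R', (Config.step queryProgram q)^[T] ⟨1, W, R, diagramMemory s L e, none⟩ =
      ⟨1, W', R', diagramMemory s L e, none⟩ ∧
      W' 0 = Fin.ofNat (s + 1) (4 * (if q i ≤ t then y else z) + 1) ∧ W' 5 = 0 := by
  obtain ⟨ha, -⟩ := List.getElem?_eq_some_iff.1 h
  have v0 : (W 0).val = 4 * a + 1 := by rw [h0, fin_val_ofNat (by omega)]
  have v1 := fin_val_add_one v0 (by omega)
  have v2 := fin_val_add_one v1 (by omega)
  have v3 := fin_val_add_one v2 (by omega)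
  have c0 := diagramMemory_wordCell (e := e) h (f := 0) (by norm_num) (by rw [v0])
  have c1 := diagramMemory_wordCell (e := e) h (f := 1) (by norm_num) v1
  have c2 := diagramMemory_wordCell (e := e) h (f := 2) (by norm_num) v2
  have c3 := diagramMemory_wordCell (e := e) h (f := 3) (by norm_num) v3
  have r0 := diagramMemory_realCell (e := e) h v0
  simp only [CompNode.word, CompNode.threshold, if_true] at c0 c1 c2 c3 r0
  norm_num at c0 c1 c2 c3
  have hi : i.val % (s + 1) = i.val := Nat.mod_eq_of_lt (by omega)
  have hs0 : s ≠ 0 := by omega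
  -- The jump on `q i ≤ t` skips one instruction, the increment that selects the second successor.
  by_cases hq : q i ≤ t
  · refine ⟨11, by norm_num, ?_⟩
    simp [Function.iterate_succ_apply, Config.step, queryProgram, Instr.exec, WordOp.eval, h5,
      c0, c1, c2, r0, hi, hs0, hq, Function.update_of_ne]
  · refine ⟨12, by norm_num, ?_⟩
    simp [Function.iterate_succ_apply, Config.step, queryProgram, Instr.exec, WordOp.eval, h5,
      c0, c1, c3, r0, hi, hs0, hq, Function.update_of_ne]

/-- At a node with an answer, the loop of the query program halts with this answer. -/
theorem iterate_step_halt {d n s : ℕ} {L : List (CompNode d n)} {e : ℕ} (q : Fin d → ℝ)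
    (hs : 4 * L.length ≤ s) {a : ℕ} {j : Fin n}
    (h : L[a]? = some (.halt j)) (W : ℕ → Fin (s + 1)) (R : ℕ → ℝ)
    (h0 : W 0 = Fin.ofNat (s + 1) (4 * a + 1)) (h5 : W 5 = 0) :
    ((Config.step queryProgram q)^[6] ⟨1, W, R, diagramMemory s L e, none⟩).out =
      some (Fin.ofNat (s + 1) j) := by
  obtain ⟨ha, -⟩ := List.getElem?_eq_some_iff.1 h
  have v0 : (W 0).val = 4 * a + 1 := by rw [h0, fin_val_ofNat (by omega)]
  have v1 := fin_val_add_one v0 (by omega)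
  have c0 := diagramMemory_wordCell (e := e) h (f := 0) (by norm_num) (by rw [v0])
  have c1 := diagramMemory_wordCell (e := e) h (f := 1) (by norm_num) v1
  simp only [CompNode.word, if_true] at c0 c1
  norm_num at c0 c1
  simp [Function.iterate_succ_apply, Config.step, queryProgram, Instr.exec, WordOp.eval, h5, c0, c1]

theorem iterate_step_of_out {prog : List Instr} {s d : ℕ} {q : Fin d → ℝ} {c : Config s}
    {w : Fin (s + 1)} (h : c.out = some w) (t : ℕ) : (Config.step prog q)^[t] c = c := by
  have : Config.step prog q c = c := by simp [Config.step, h]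
  exact Function.iterate_fixed this t

theorem exists_iterate_step_of_reaches {d n s : ℕ} {L : List (CompNode d n)} {e : ℕ}
    {q : Fin d → ℝ} (hs : 4 * L.length ≤ s) (hd : d ≤ s) {m a b : ℕ} (hr : Reaches L q m a b)
    {j : Fin n} (hb : L[b]? = some (.halt j)) (W : ℕ → Fin (s + 1)) (R : ℕ → ℝ)
    (h0 : W 0 = Fin.ofNat (s + 1) (4 * a + 1)) (h5 : W 5 = 0) :
    ∃ T ≤ 12 * m + 6, ((Config.step queryProgram q)^[T]
      ⟨1, W, R, diagramMemory s L e, none⟩).out = some (Fin.ofNat (s + 1) j) := by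
  induction hr generalizing W R with
  | refl a => exact ⟨6, by omega, iterate_step_halt q hs hb W R h0 h5⟩
  | step h _ ih =>
    obtain ⟨T, hT, W', R', hc, h0', h5'⟩ := iterate_step_cmp (e := e) q hs hd h W R h0 h5
    obtain ⟨T', hT', ho⟩ := ih hb W' R' h0' h5'
    exact ⟨T' + T, by omega, by rw [Function.iterate_add_apply, hc, ho]⟩

/-- The query program evaluates the diagram in its memory, at a cost of at most `12` steps per
comparison. -/
theorem outputWithin_diagramMemory {d n s : ℕ} {L : List (CompNode d n)} {e : ℕ}
    {q : Fin d → ℝ} (hs : 4 * L.length ≤ s) (hd : d ≤ s) {m b : ℕ} (hr : Reaches L q m e b)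
    {j : Fin n} (hb : L[b]? = some (.halt j)) {t : ℕ} (ht : 12 * m + 7 ≤ t) :
    outputWithin queryProgram t (diagramMemory s L e) q = some (Fin.ofNat (s + 1) j) := by
  have hstart : Config.step queryProgram q (diagramMemory s L e).start =
      ⟨1, Function.update (fun _ => 0) 0 (Fin.ofNat (s + 1) (4 * e + 1)), fun _ => 0,
        diagramMemory s L e, none⟩ := by
    simp [Config.step, queryProgram, Instr.exec, Memory.start, diagramMemory]
  obtain ⟨T, hT, ho⟩ := exists_iterate_step_of_reaches (e := e) hs hd hr hb
    (Function.update (fun _ => 0) 0 (Fin.ofNat (s + 1) (4 * e + 1))) (fun _ => 0)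
    (by simp) (by simp)
  obtain ⟨t', rfl⟩ : ∃ t', t = t' + T + 1 := ⟨t - T - 1, by omega⟩
  rw [outputWithin, Function.iterate_succ_apply, hstart, Function.iterate_add_apply,
    iterate_step_of_out ho, ho]

/-! ### Building diagrams from the exits to the entry -/

/-- A box test: `2 * I.length` new nodes decide whether `lo i < q i ≤ hi i` for all `i` in `I`,
and lead to `y` or to `k` accordingly. -/
theorem exists_boxTest {d n : ℕ} (L : List (CompNode d n)) (lo hi : Fin d → ℝ) (y k : ℕ)
    (I : List (Fin d)) : ∃ (L' : List (CompNode d n)) (e : ℕ), L <+: L' ∧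
      L'.length = L.length + 2 * I.length ∧ ∀ q : Fin d → ℝ, ∃ m ≤ 2 * I.length,
        ∃ b, Reaches L' q m e b ∧
          ((b = y ∧ ∀ i ∈ I, lo i < q i ∧ q i ≤ hi i) ∨
            (b = k ∧ ∃ i ∈ I, ¬ (lo i < q i ∧ q i ≤ hi i))) := by
  induction I with
  | nil => exact ⟨L, y, List.prefix_rfl, by simp, fun q => ⟨0, by simp, y, .refl y, by simp⟩⟩
  | cons i I ih =>
    obtain ⟨L', e, hL, hlen, h⟩ := ih
    have hL1 : L' <+: L' ++ [.cmp i (hi i) e k, .cmp i (lo i) k L'.length] := List.prefix_append _ _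
    refine ⟨_, L'.length + 1, hL.trans hL1, by simp [hlen]; ring, fun q => ?_⟩
    have g0 : (L' ++ [.cmp i (hi i) e k, .cmp i (lo i) k L'.length])[L'.length]? =
      some (.cmp i (hi i) e k) := by simp
    have g1 : (L' ++ [.cmp i (hi i) e k, .cmp i (lo i) k L'.length])[L'.length + 1]? =
      some (.cmp i (lo i) k L'.length) := by
        rw [List.getElem?_append_right (by omega)]; simp
    by_cases hlo : q i ≤ lo i
    · refine ⟨1, by simp; omega, k, .step g1 ?_, .inr ⟨rfl, i, by simp, fun h => ?_⟩⟩
      · simpa [hlo] using Reaches.refl k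
      · exact absurd h.1 (not_lt.2 hlo)
    by_cases hhi : q i ≤ hi i
    · obtain ⟨m, hm, b, hr, hb⟩ := h q
      refine ⟨m + 1 + 1, by simp; omega, b, .step g1 ?_, ?_⟩
      · rw [if_neg hlo]
        refine .step g0 ?_
        rw [if_pos hhi]
        exact hr.mono hL1
      · rcases hb with ⟨hb, hI⟩ | ⟨hb, i', hi', hI⟩
        · exact .inl ⟨hb, by simpa [hhi, not_le.1 hlo] using hI⟩
        · exact .inr ⟨hb, i', by simp [hi'], hI⟩
    · refine ⟨1 + 1, by simp, k, .step g1 ?_, .inr ⟨rfl, i, by simp, fun h => ?_⟩⟩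
      · rw [if_neg hlo]
        refine .step g0 ?_
        rw [if_neg hhi]; exact .refl k
      · exact hhi h.2

/-! ### Splitting a point set in the maximum norm -/

/-- Splitting the points of `A` along the coordinate function `x` at the threshold `t`, with the
points within distance `1` of `t` going to both sides, is good if the bound `m ^ (1 + δ)` on the
number of leaves survives, and both sides lose at least the fraction `κ` of the points. -/
def IsGoodSplit {ι : Type*} (δ κ : ℝ) (A : Finset ι) (x : ι → ℝ) (t : ℝ) : Prop :=
  ((A.filter fun j => x j ≤ t + 1).card : ℝ) ^ (1 + δ) +
      ((A.filter fun j => t - 1 ≤ x j).card : ℝ) ^ (1 + δ) ≤ (A.card : ℝ) ^ (1 + δ) ∧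
    ((A.filter fun j => x j ≤ t + 1).card : ℝ) ≤ (1 - κ) * A.card ∧
    ((A.filter fun j => t - 1 ≤ x j).card : ℝ) ≤ (1 - κ) * A.card

theorem IsGoodSplit.of_neg {ι : Type*} {δ κ : ℝ} {A : Finset ι} {x : ι → ℝ} {t : ℝ}
    (h : IsGoodSplit δ κ A (fun j => -x j) t) : IsGoodSplit δ κ A x (-t) := by
  have h1 : (A.filter fun j => -x j ≤ t + 1) = A.filter fun j => -t - 1 ≤ x j :=
    Finset.filter_congr fun j _ => ⟨fun h => by linarith, fun h => by linarith⟩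
  have h2 : (A.filter fun j => t - 1 ≤ -x j) = A.filter fun j => x j ≤ -t + 1 :=
    Finset.filter_congr fun j _ => ⟨fun h => by linarith, fun h => by linarith⟩
  obtain ⟨ha, hb, hc⟩ := h
  simp only [h1, h2] at ha hb hc
  exact ⟨by rwa [add_comm], hc, hb⟩

theorem one_sub_rpow_add_rpow_le_one {δ a b : ℝ} (hδ : 0 < δ) (hb0 : 0 ≤ b) (hb1 : b ≤ 1)
    (hab : a ^ (1 + δ) ≤ b) : (1 - b) ^ (1 + δ) + a ^ (1 + δ) ≤ 1 := by
  have : (1 - b) ^ (1 + δ) ≤ (1 - b) ^ (1 : ℝ) := by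
    rcases eq_or_lt_of_le hb1 with rfl | h
    · simp [Real.zero_rpow (by linarith : 1 + δ ≠ 0)]
    · exact Real.rpow_le_rpow_of_exponent_ge (by linarith) (by linarith) (by linarith)
  rw [Real.rpow_one] at this
  linarith

/-- Without a good split, the fraction of the points beyond `c + 3 * k` shrinks doubly
exponentially in `k`, from `1 / 2` down to `κ`: otherwise the threshold `c + 3 * k + 3 / 2` would
give a good split. -/
theorem card_filter_gt_le_of_not_isGoodSplit {ι : Type*} {δ κ : ℝ} (hδ : 0 < δ) (hκ0 : 0 < κ)
    (hκ : κ ≤ 1 / 2) {A : Finset ι} (hA : A.Nonempty) {x : ι → ℝ} {c : ℝ}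
    (hc : ((A.filter fun j => c < x j).card : ℝ) ≤ A.card / 2)
    (hx : ∀ t, ¬ IsGoodSplit δ κ A x t) (k : ℕ) :
    ((A.filter fun j => c + 3 * k < x j).card : ℝ) ≤
      max κ ((1 / 2 : ℝ) ^ ((1 + δ) ^ k)) * A.card := by
  have hm : (0 : ℝ) < A.card := by exact_mod_cast hA.card_pos
  induction k with
  | zero =>
    have : (1 / 2 : ℝ) ≤ max κ ((1 / 2 : ℝ) ^ ((1 + δ) ^ 0)) := by simp
    simp only [Nat.cast_zero, mul_zero, add_zero]
    nlinarith
  | succ k ih =>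
    set m : ℝ := (A.card : ℝ)
    obtain ⟨a, ha⟩ : ∃ a : ℝ, ((A.filter fun j => c + 3 * k < x j).card : ℝ) = a * m :=
      ⟨_, (div_mul_cancel₀ _ hm.ne').symm⟩
    obtain ⟨b, hb⟩ : ∃ b : ℝ, ((A.filter fun j => c + 3 * (k + 1 : ℕ) < x j).card : ℝ) = b * m :=
      ⟨_, (div_mul_cancel₀ _ hm.ne').symm⟩
    have hk0 : (0 : ℝ) ≤ k := k.cast_nonneg
    have hb0 : 0 ≤ b := by
      have : 0 ≤ b * m := by rw [← hb]; positivity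
      exact nonneg_of_mul_nonneg_left this hm
    have hba : b ≤ a := by
      refine le_of_mul_le_mul_right ?_ hm
      rw [← ha, ← hb]
      refine Nat.cast_le.2 (Finset.card_le_card fun j => ?_)
      simp only [Finset.mem_filter, Nat.cast_add, Nat.cast_one]
      exact fun h => ⟨h.1, by linarith [h.2]⟩
    have ha2 : a ≤ 1 / 2 := by
      refine le_of_mul_le_mul_right ?_ hm
      rw [← ha]
      refine le_trans (Nat.cast_le.2 (Finset.card_le_card fun j => ?_)) (hc.trans (by linarith))
      simp only [Finset.mem_filter]
      exact fun h => ⟨h.1, by linarith [h.2]⟩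
    rw [ha] at ih
    rw [hb]
    refine mul_le_mul_of_nonneg_right ?_ hm.le
    have ih := le_of_mul_le_mul_right ih hm
    by_cases hbκ : b ≤ κ
    · exact hbκ.trans (le_max_left _ _)
    rw [not_le] at hbκ
    have ha' : a ≤ (1 / 2 : ℝ) ^ ((1 + δ) ^ k) :=
      (le_max_iff.1 ih).resolve_left (by linarith)
    have hpow : a ^ (1 + δ) ≤ (1 / 2 : ℝ) ^ ((1 + δ) ^ (k + 1)) := by
      rw [pow_succ, Real.rpow_mul (by norm_num)]
      exact Real.rpow_le_rpow (by linarith) ha' (by linarith)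
    refine le_trans ?_ (hpow.trans (le_max_right _ _))
    by_contra hlt
    rw [not_le] at hlt
    have h1 : ((A.filter fun j => x j ≤ c + 3 * k + 3 / 2 + 1).card : ℝ) ≤ (1 - b) * m := by
      have hsum : ((A.filter fun j => x j ≤ c + 3 * k + 3 / 2 + 1).card : ℝ) +
          ((A.filter fun j => ¬ x j ≤ c + 3 * k + 3 / 2 + 1).card : ℝ) = m := by
        rw [← Nat.cast_add, Finset.card_filter_add_card_filter_not]
      have : b * m ≤ ((A.filter fun j => ¬ x j ≤ c + 3 * k + 3 / 2 + 1).card : ℝ) := by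
        rw [← hb]
        refine Nat.cast_le.2 (Finset.card_le_card fun j => ?_)
        simp only [Finset.mem_filter, Nat.cast_add, Nat.cast_one, not_le]
        exact fun h => ⟨h.1, by linarith [h.2]⟩
      linarith
    have h2 : ((A.filter fun j => c + 3 * k + 3 / 2 - 1 ≤ x j).card : ℝ) ≤ a * m := by
      rw [← ha]
      refine Nat.cast_le.2 (Finset.card_le_card fun j => ?_)
      simp only [Finset.mem_filter]
      exact fun h => ⟨h.1, by linarith [h.2]⟩
    -- The step `3` of the tails is larger than the width `2` of the split, so strict and non-strict
    -- inequalities need not be distinguished, and the lemma can be reflected.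
    refine hx (c + 3 * k + 3 / 2) ⟨?_, ?_, ?_⟩
    · calc _ ≤ ((1 - b) * m) ^ (1 + δ) + (a * m) ^ (1 + δ) := by gcongr
        _ = ((1 - b) ^ (1 + δ) + a ^ (1 + δ)) * m ^ (1 + δ) := by
          rw [Real.mul_rpow (by linarith) hm.le, Real.mul_rpow (by linarith) hm.le]; ring
        _ ≤ 1 * m ^ (1 + δ) := by
          gcongr
          exact one_sub_rpow_add_rpow_le_one hδ hb0 (by linarith) hlt.le
        _ = m ^ (1 + δ) := one_mul _
    · exact h1.trans (by gcongr)
    · exact h2.trans (by gcongr; linarith)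

theorem exists_median {ι : Type*} {A : Finset ι} (hA : A.Nonempty) (x : ι → ℝ) :
    ∃ c : ℝ, ((A.filter fun j => c < x j).card : ℝ) ≤ A.card / 2 ∧
      ((A.filter fun j => x j < c).card : ℝ) ≤ A.card / 2 := by
  set S := (A.image x).filter fun c => ((A.filter fun j => c < x j).card : ℝ) ≤ A.card / 2
  have hne : (A.image x).Nonempty := hA.image x
  have hSne : S.Nonempty := by
    refine ⟨(A.image x).max' hne, Finset.mem_filter.2 ⟨Finset.max'_mem _ _, ?_⟩⟩
    rw [Finset.filter_eq_empty_iff.2 fun j hj => not_lt.2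
      (Finset.le_max' _ _ (Finset.mem_image_of_mem x hj))]
    simp; positivity
  have hmin := S.min'_mem hSne
  refine ⟨S.min' hSne, (Finset.mem_filter.1 hmin).2, ?_⟩
  set c := S.min' hSne
  -- The largest value below `c` is not in `S`, so that more than half of the points are above it.
  by_cases hB : (A.filter fun j => x j < c).Nonempty
  · have hB' := hB.image x
    set y := ((A.filter fun j => x j < c).image x).max' hB'
    obtain ⟨j0, hj0, hy⟩ := Finset.mem_image.1 (Finset.max'_mem _ hB')
    obtain ⟨hj0A, hj0c⟩ := Finset.mem_filter.1 hj0
    have hyc : y < c := hy.symm.trans_lt hj0c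
    have hyS : y ∉ S := fun h => absurd (S.min'_le _ h) (not_le.2 hyc)
    have hy2 : (A.card : ℝ) / 2 < (A.filter fun j => y < x j).card := by
      by_contra h
      exact hyS (Finset.mem_filter.2 ⟨Finset.mem_image.2 ⟨j0, hj0A, hy⟩, not_lt.1 h⟩)
    have hsub : (A.filter fun j => x j < c) ⊆ A.filter fun j => ¬ y < x j := by
      intro j hj
      refine Finset.mem_filter.2 ⟨(Finset.mem_filter.1 hj).1, not_lt.2 ?_⟩
      exact Finset.le_max' _ _ (Finset.mem_image_of_mem x hj)
    have hsum : ((A.filter fun j => y < x j).card : ℝ) +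
        ((A.filter fun j => ¬ y < x j).card : ℝ) = A.card := by
      exact_mod_cast A.card_filter_add_card_filter_not _
    have : ((A.filter fun j => x j < c).card : ℝ) ≤ (A.filter fun j => ¬ y < x j).card :=
      Nat.cast_le.2 (Finset.card_le_card hsub)
    linarith
  · rw [Finset.not_nonempty_iff_eq_empty.1 hB]
    simp; positivity

/-- Either some coordinate has a good split, or a box of radius `3 * l` contains at least half of
the points. -/
theorem exists_isGoodSplit_or_box {ι : Type*} {d : ℕ} (hd : 1 ≤ d) {δ : ℝ} (hδ : 0 < δ) {l : ℕ}
    (hl : (1 / 2 : ℝ) ^ ((1 + δ) ^ l) ≤ 1 / (4 * d)) {A : Finset ι} (hA : A.Nonempty)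
    (x : ι → Fin d → ℝ) :
    (∃ i t, IsGoodSplit δ (1 / (4 * d)) A (fun j => x j i) t) ∨
      ∃ c : Fin d → ℝ, ((A.filter fun j => ∃ i, 3 * (l : ℝ) < |x j i - c i|).card : ℝ) ≤
        A.card / 2 := by
  by_cases h : ∃ i t, IsGoodSplit δ (1 / (4 * d)) A (fun j => x j i) t
  · exact .inl h
  right
  push Not at h
  choose c hc1 hc2 using fun i => exists_median hA fun j => x j i
  refine ⟨c, ?_⟩
  have hd' : (1 : ℝ) ≤ d := by exact_mod_cast hd
  have hκ0 : (0 : ℝ) < 1 / (4 * d) := by positivity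
  have hκ : 1 / (4 * d : ℝ) ≤ 1 / 2 := by
    apply one_div_le_one_div_of_le <;> linarith
  have hside (i : Fin d) : ((A.filter fun j => c i + 3 * l < x j i).card : ℝ) ≤
      1 / (4 * d) * A.card := by
    rw [← max_eq_left hl]
    exact card_filter_gt_le_of_not_isGoodSplit hδ hκ0 hκ hA (hc1 i) (h i) l
  -- The lower side is the upper side for the reflected points.
  have hside' (i : Fin d) : ((A.filter fun j => -c i + 3 * l < -x j i).card : ℝ) ≤
      1 / (4 * d) * A.card := by
    have hneg : ((A.filter fun j => -c i < -x j i).card : ℝ) ≤ A.card / 2 := by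
      simpa using hc2 i
    rw [← max_eq_left hl]
    exact card_filter_gt_le_of_not_isGoodSplit hδ hκ0 hκ hA hneg
      (fun t ht => h i _ ht.of_neg) l
  classical
  have hsub : (A.filter fun j => ∃ i, 3 * (l : ℝ) < |x j i - c i|) ⊆
      Finset.univ.biUnion fun i => (A.filter fun j => c i + 3 * l < x j i) ∪
        (A.filter fun j => -c i + 3 * l < -x j i) := by
    intro j hj
    obtain ⟨hjA, i, hi⟩ := Finset.mem_filter.1 hj
    simp only [Finset.mem_biUnion, Finset.mem_univ, true_and, Finset.mem_union, Finset.mem_filter]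
    rcases lt_abs.1 hi with hi | hi
    · exact ⟨i, .inl ⟨hjA, by linarith⟩⟩
    · exact ⟨i, .inr ⟨hjA, by linarith⟩⟩
  calc _ ≤ ((∑ i : Fin d, ((A.filter fun j => c i + 3 * l < x j i).card +
          (A.filter fun j => -c i + 3 * l < -x j i).card) : ℕ) : ℝ) := by
        refine Nat.cast_le.2 ((Finset.card_le_card hsub).trans (Finset.card_biUnion_le.trans ?_))
        exact Finset.sum_le_sum fun i _ => Finset.card_union_le _ _
    _ ≤ ∑ i : Fin d, (1 / (4 * d) * A.card + 1 / (4 * d) * A.card : ℝ) := by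
        push_cast
        exact Finset.sum_le_sum fun i _ => add_le_add (hside i) (hside' i)
    _ = A.card / 2 := by
        simp only [Finset.sum_const, Finset.card_univ, Fintype.card_fin, nsmul_eq_mul]
        field_simp; ring

/-! ### The diagram for near neighbors in a weighted maximum norm -/

theorem log_two_mul_add_one_of_box {m m' : ℝ} (hm : 1 ≤ m) (h0 : 0 ≤ m') (h : m' ≤ m / 2) :
    1 / 3 + Real.log (2 * m' + 1) ≤ Real.log (2 * m + 1) := by
  have h1 : Real.log (2 * m' + 1) ≤ Real.log ((2 * m + 1) / (3 / 2)) :=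
    Real.log_le_log (by linarith) (by linarith)
  rw [Real.log_div (by linarith) (by norm_num)] at h1
  have h2 := Real.one_sub_inv_le_log_of_pos (x := 3 / 2) (by norm_num)
  norm_num at h2 ⊢
  linarith

theorem log_two_mul_add_one_of_split {m m' d : ℝ} (hd : 1 ≤ d) (hm : 1 ≤ m) (h0 : 0 ≤ m')
    (h : m' ≤ (1 - 1 / (4 * d)) * m) :
    1 / (6 * d) + Real.log (2 * m' + 1) ≤ Real.log (2 * m + 1) := by
  have hd0 : 0 < d := by linarith
  have hd1 : 1 / (6 * d) ≤ 1 / 6 := one_div_le_one_div_of_le (by norm_num) (by linarith)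
  have h1 : 2 * m' + 1 ≤ (1 - 1 / (6 * d)) * (2 * m + 1) := by
    have e : 1 / (4 * d) = 3 / 2 * (1 / (6 * d)) := by field_simp; norm_num
    have : 0 < 1 / (6 * d) := by positivity
    rw [e] at h
    nlinarith
  have h2 : Real.log (2 * m' + 1) ≤ Real.log ((1 - 1 / (6 * d)) * (2 * m + 1)) :=
    Real.log_le_log (by linarith) h1
  rw [Real.log_mul (by linarith) (by linarith)] at h2
  have h3 := Real.log_le_sub_one_of_pos (x := 1 - 1 / (6 * d)) (by linarith)
  linarith

theorem half_rpow_le {δ m : ℝ} (hδ : 0 ≤ δ) (hm : 0 ≤ m) :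
    (m / 2) ^ (1 + δ) ≤ m ^ (1 + δ) / 2 := by
  rw [Real.div_rpow hm (by norm_num)]
  have : (2 : ℝ) ^ (1 : ℝ) ≤ 2 ^ (1 + δ) :=
    Real.rpow_le_rpow_of_exponent_le (by norm_num) (by linarith)
  rw [Real.rpow_one] at this
  gcongr

/-- A diagram `L` with an exit `k` can be prolonged to a diagram that, on a query `q`, either answers
with a point that has distance at most `6 * l + 2` from `q` in the maximum norm with weights `1 / u`,
or leaves to `k` and no point of `A` has distance at most `1`. The induction is on the number of
points: a good split sends the points to two smaller diagrams, and a box that contains half of the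
points answers the queries in its neighborhood, so that the others need only the remaining points.
For the sake of the induction the size bound has one node to spare if `A` is nonempty, which pays for
the comparison at a split, and the depth is measured by `log (2 * m + 1)`, which vanishes at `m = 0`. -/
theorem exists_maxNormDiagram {d n : ℕ} (hd : 1 ≤ d) {δ : ℝ} (hδ : 0 < δ) {l : ℕ}
    (hl : (1 / 2 : ℝ) ^ ((1 + δ) ^ l) ≤ 1 / (4 * d)) (P : Fin n → Fin d → ℝ) {u : Fin d → ℝ}
    (hu : ∀ i, 0 < u i) (A : Finset (Fin n)) (L : List (CompNode d n)) (k : ℕ) :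
    ∃ (L' : List (CompNode d n)) (e : ℕ), L <+: L' ∧
      ((L'.length + min 1 A.card : ℕ) : ℝ) ≤ L.length + 8 * d * (A.card : ℝ) ^ (1 + δ) ∧
      ∀ q : Fin d → ℝ, ∃ m b : ℕ, (m : ℝ) ≤ 6 * d * Real.log (2 * A.card + 1) ∧
        Reaches L' q m e b ∧
        ((∃ j, L'[b]? = some (.halt j) ∧ ∀ i, |P j i - q i| ≤ (6 * l + 2) * u i) ∨
          (b = k ∧ ¬ ∃ j ∈ A, ∀ i, |P j i - q i| ≤ u i)) := by
  have hd' : (1 : ℝ) ≤ d := by exact_mod_cast hd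
  induction hN : A.card using Nat.strong_induction_on generalizing A L k with
  | _ N ih =>
  subst hN
  rcases A.eq_empty_or_nonempty with rfl | hA
  · refine ⟨L, k, List.prefix_rfl, ?_, fun q => ⟨0, k, by simp, .refl k, .inr ⟨rfl, by simp⟩⟩⟩
    simp [Real.zero_rpow (by linarith : 1 + δ ≠ 0)]
  have hA1 : 1 ≤ A.card := hA.card_pos
  have hA1' : (1 : ℝ) ≤ A.card := by exact_mod_cast hA1
  rcases exists_isGoodSplit_or_box hd hδ hl hA (fun j i => P j i / u i) with
    ⟨i, t, hsum, h1, h2⟩ | ⟨c, hc⟩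
  · set A1 := A.filter fun j => P j i / u i ≤ t + 1
    set A2 := A.filter fun j => t - 1 ≤ P j i / u i
    have hκ : 0 < 1 / (4 * (d : ℝ)) := by positivity
    have hlt {B : Finset (Fin n)} (hB : (B.card : ℝ) ≤ (1 - 1 / (4 * (d : ℝ))) * A.card) :
        B.card < A.card := by
      have : (B.card : ℝ) < A.card := by nlinarith
      exact_mod_cast this
    have hcover : A.card ≤ A1.card + A2.card := by
      refine (Finset.card_le_card fun j hj => ?_).trans (Finset.card_union_le _ _)
      rcases le_total (P j i / u i) t with h | h
      · exact Finset.mem_union_left _ (Finset.mem_filter.2 ⟨hj, by linarith⟩)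
      · exact Finset.mem_union_right _ (Finset.mem_filter.2 ⟨hj, by linarith⟩)
    have hl1 := hlt h1
    have hl2 := hlt h2
    -- Both halves get the same exit `k`, and the second one to be built is appended to the first.
    obtain ⟨L2, e2, hL2, hs2, hq2⟩ := ih _ hl2 A2 L k rfl
    obtain ⟨L1, e1, hL1, hs1, hq1⟩ := ih _ hl1 A1 L2 k rfl
    have hL' : L1 <+: L1 ++ [.cmp i (t * u i) e1 e2] := List.prefix_append _ _
    have hnode : (L1 ++ [.cmp i (t * u i) e1 e2])[L1.length]? =
      some (.cmp i (t * u i) e1 e2) := by simp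
    refine ⟨_, L1.length, (hL2.trans hL1).trans hL', ?_, fun q => ?_⟩
    · rw [min_eq_left (by omega)] at hs1 hs2 ⊢
      rw [List.length_append, List.length_singleton]
      push_cast at hs1 hs2 ⊢
      have := mul_le_mul_of_nonneg_left hsum (by positivity : (0 : ℝ) ≤ 8 * d)
      linarith
    · have hdepth {m m' : ℕ} (hm : (m : ℝ) ≤ 6 * d * Real.log (2 * m' + 1))
          (hm' : (m' : ℝ) ≤ (1 - 1 / (4 * (d : ℝ))) * A.card) :
          ((m + 1 : ℕ) : ℝ) ≤ 6 * d * Real.log (2 * A.card + 1) := by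
        have := mul_le_mul_of_nonneg_left
          (log_two_mul_add_one_of_split hd' hA1' m'.cast_nonneg hm')
          (by positivity : (0 : ℝ) ≤ 6 * d)
        rw [mul_add, mul_one_div_cancel (by positivity)] at this
        push_cast
        linarith
      by_cases hq : q i ≤ t * u i
      · obtain ⟨m, b, hm, hr, hb⟩ := hq1 q
        refine ⟨m + 1, b, hdepth hm h1, .step hnode (by rw [if_pos hq]; exact hr.mono hL'), ?_⟩
        refine hb.imp (fun ⟨j, hj, h⟩ => ⟨j, getElem?_of_prefix hL' hj, h⟩)
          (fun ⟨hb, h⟩ => ⟨hb, fun ⟨j, hj, hjq⟩ => h ⟨j, Finset.mem_filter.2 ⟨hj, ?_⟩, hjq⟩⟩)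
        rw [div_le_iff₀ (hu i)]
        linarith [(abs_le.1 (hjq i)).2]
      · obtain ⟨m, b, hm, hr, hb⟩ := hq2 q
        refine ⟨m + 1, b, hdepth hm h2,
          .step hnode (by rw [if_neg hq]; exact (hr.mono hL1).mono hL'), ?_⟩
        refine hb.imp
          (fun ⟨j, hj, h⟩ => ⟨j, getElem?_of_prefix hL' (getElem?_of_prefix hL1 hj), h⟩)
          (fun ⟨hb, h⟩ => ⟨hb, fun ⟨j, hj, hjq⟩ => h ⟨j, Finset.mem_filter.2 ⟨hj, ?_⟩, hjq⟩⟩)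
        rw [le_div_iff₀ (hu i)]
        linarith [(abs_le.1 (hjq i)).1]
  · set B := A.filter fun j => ∃ i, 3 * (l : ℝ) < |P j i / u i - c i|
    have hBlt : B.card < A.card := by
      have : (B.card : ℝ) < A.card := by linarith
      exact_mod_cast this
    obtain ⟨j0, hj0A, hj0⟩ : ∃ j0 ∈ A, ∀ i, |P j0 i / u i - c i| ≤ 3 * l := by
      by_contra! h
      refine hBlt.ne (congrArg Finset.card (Finset.filter_eq_self.2 fun j hj => h j hj))
    obtain ⟨L1, e1, hL1, hs1, hq1⟩ := ih _ hBlt B L k rfl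
    have hL2 : L1 <+: L1 ++ [.halt j0] := List.prefix_append _ _
    have hnode : (L1 ++ [CompNode.halt (d := d) j0])[L1.length]? = some (.halt j0) := by simp
    -- A query at distance at most `1` from a point of the box is within `3 * l + 1` of its center;
    -- the margin `2` makes up for the strict lower inequality of the box test.
    obtain ⟨L3, e, hL3, hs3, hq3⟩ := exists_boxTest (L1 ++ [.halt j0])
      (fun i => (c i - (3 * l + 2)) * u i) (fun i => (c i + (3 * l + 2)) * u i)
      L1.length e1 (List.finRange d)
    rw [List.length_finRange] at hs3 hq3
    refine ⟨L3, e, (hL1.trans hL2).trans hL3, ?_, fun q => ?_⟩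
    · rw [min_eq_left hA1, hs3, List.length_append, List.length_singleton]
      have hs1' : (L1.length : ℝ) ≤ L.length + 8 * d * (B.card : ℝ) ^ (1 + δ) :=
        le_trans (Nat.cast_le.2 (Nat.le_add_right _ _)) hs1
      have hpow : (B.card : ℝ) ^ (1 + δ) ≤ (A.card : ℝ) ^ (1 + δ) / 2 :=
        (Real.rpow_le_rpow (Nat.cast_nonneg _) hc (by linarith)).trans
          (half_rpow_le hδ.le (Nat.cast_nonneg _))
      have hone : 1 ≤ (A.card : ℝ) ^ (1 + δ) := Real.one_le_rpow hA1' (by linarith)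
      push_cast
      nlinarith
    · obtain ⟨m, hm, b, hr, hb⟩ := hq3 q
      have hm' : (m : ℝ) ≤ 2 * d := by exact_mod_cast hm
      have hlog : 2 * d + 6 * d * Real.log (2 * B.card + 1) ≤
          6 * d * Real.log (2 * A.card + 1) := by
        have := log_two_mul_add_one_of_box hA1' (Nat.cast_nonneg B.card) hc
        nlinarith
      have hlog0 : 0 ≤ 6 * d * Real.log (2 * (B.card : ℝ) + 1) :=
        mul_nonneg (by positivity) (Real.log_nonneg (by linarith [B.card.cast_nonneg (α := ℝ)]))
      have hjz (j : Fin n) (i : Fin d) : P j i = P j i / u i * u i :=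
        (div_mul_cancel₀ _ (hu i).ne').symm
      rcases hb with ⟨rfl, hin⟩ | ⟨rfl, i, -, hout⟩
      · refine ⟨m, _, by linarith, hr, .inl ⟨j0, getElem?_of_prefix hL3 hnode, fun i => ?_⟩⟩
        obtain ⟨hlo, hhi⟩ := hin i (List.mem_finRange i)
        obtain ⟨h1, h2⟩ := abs_le.1 (hj0 i)
        rw [hjz, abs_le]
        constructor <;> nlinarith [hu i]
      · obtain ⟨m2, b2, hm2, hr2, hb2⟩ := hq1 q
        refine ⟨m + m2, b2, by push_cast; linarith, hr.trans ((hr2.mono hL2).mono hL3), ?_⟩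
        refine hb2.imp
          (fun ⟨j, hj, h⟩ => ⟨j, getElem?_of_prefix hL3 (getElem?_of_prefix hL2 hj), h⟩)
          (fun ⟨hb, h⟩ => ⟨hb, fun ⟨j, hj, hjq⟩ => ?_⟩)
        by_cases hjB : j ∈ B
        · exact h ⟨j, hjB, hjq⟩
        have hji : |P j i / u i - c i| ≤ 3 * l := by
          by_contra hcon
          exact hjB (Finset.mem_filter.2 ⟨hj, i, not_le.1 hcon⟩)
        obtain ⟨h1, h2⟩ := abs_le.1 hji
        obtain ⟨h3, h4⟩ := abs_le.1 (hjq i)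
        rw [hjz] at h3 h4
        exact hout ⟨by nlinarith [hu i], by nlinarith [hu i]⟩

/-- Diagrams for several weight vectors `u k` in a row: the combined diagram always answers, and with
a point that is near for some weight vector if there is such a point. -/
theorem exists_repeatedDiagram {d n : ℕ} (hd : 1 ≤ d) (hn : 1 ≤ n) {δ : ℝ} (hδ : 0 < δ) {l : ℕ}
    (hl : (1 / 2 : ℝ) ^ ((1 + δ) ^ l) ≤ 1 / (4 * d)) (P : Fin n → Fin d → ℝ) {N : ℕ}
    (u : Fin N → Fin d → ℝ) (hu : ∀ k i, 0 < u k i) :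
    ∃ (L : List (CompNode d n)) (e : ℕ),
      (L.length : ℝ) ≤ 1 + N * (8 * d * (n : ℝ) ^ (1 + δ)) ∧
      ∀ q : Fin d → ℝ, ∃ (m b : ℕ) (j : Fin n), (m : ℝ) ≤ N * (6 * d * Real.log (2 * n + 1)) ∧
        Reaches L q m e b ∧ L[b]? = some (.halt j) ∧
        ((∃ k, ∀ i, |P j i - q i| ≤ (6 * l + 2) * u k i) ∨
          ¬ ∃ k j', ∀ i, |P j' i - q i| ≤ u k i) := by
  induction N with
  | zero => exact ⟨[.halt ⟨0, hn⟩], 0, by simp, fun q =>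
      ⟨0, 0, ⟨0, hn⟩, by simp, .refl 0, by simp, .inr (by simp)⟩⟩
  | succ N ih =>
    obtain ⟨L, e, hL, h⟩ := ih (fun k => u k.succ) (fun k => hu k.succ)
    obtain ⟨L', e', hLL', hL', h'⟩ :=
      exists_maxNormDiagram hd hδ hl P (hu 0) Finset.univ L e
    rw [Finset.card_univ, Fintype.card_fin] at hL' h'
    refine ⟨L', e', ?_, fun q => ?_⟩
    · have : (L'.length : ℝ) ≤ L.length + 8 * d * (n : ℝ) ^ (1 + δ) :=
        le_trans (Nat.cast_le.2 (Nat.le_add_right _ _)) hL'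
      push_cast
      linarith
    · obtain ⟨m', b', hm', hr', hb'⟩ := h' q
      rcases hb' with ⟨j, hj, hjq⟩ | ⟨rfl, hno⟩
      · refine ⟨m', b', j, hm'.trans ?_, hr', hj, .inl ⟨0, hjq⟩⟩
        have : 0 ≤ N * (6 * d * Real.log (2 * (n : ℝ) + 1)) :=
          mul_nonneg (by positivity) (mul_nonneg (by positivity)
            (Real.log_nonneg (by linarith [n.cast_nonneg (α := ℝ)])))
        push_cast
        linarith
      · obtain ⟨m, b, j, hm, hr, hb, hjq⟩ := h q
        refine ⟨m' + m, b, j, by push_cast; linarith, hr'.trans (hr.mono hLL'),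
          getElem?_of_prefix hLL' hb, hjq.imp (fun ⟨k, hk⟩ => ⟨k.succ, hk⟩) ?_⟩
        rintro hno' ⟨k, j', hk⟩
        refine k.cases (fun hk => ?_) (fun k hk => ?_) hk
        · exact hno ⟨j', Finset.mem_univ _, hk⟩
        · exact hno' ⟨k, j', hk⟩

/-! ### Orlicz functions and norms -/

namespace IsOrliczFunction

variable {G : ℝ≥0 → ℝ≥0}

theorem map_mul_le (hG : IsOrliczFunction G) {s : ℝ≥0} (hs : s ≤ 1) (t : ℝ≥0) :
    G (s * t) ≤ s * G t := by
  have := hG.convex.2 (Set.mem_univ t) (Set.mem_univ 0) (zero_le (a := s)) (zero_le (a := 1 - s))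
    (add_tsub_cancel_of_le hs)
  simpa [hG.map_zero] using this

theorem mul_map_le (hG : IsOrliczFunction G) {s : ℝ≥0} (hs : 1 ≤ s) (t : ℝ≥0) :
    s * G t ≤ G (s * t) := by
  have hs0 : s ≠ 0 := (zero_lt_one.trans_le hs).ne'
  have := hG.map_mul_le (inv_le_one_of_one_le₀ hs) (s * t)
  rw [inv_mul_cancel_left₀ hs0] at this
  calc s * G t ≤ s * (s⁻¹ * G (s * t)) := by gcongr
    _ = G (s * t) := mul_inv_cancel_left₀ hs0 _

theorem monotone (hG : IsOrliczFunction G) : Monotone G := by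
  intro a b hab
  rcases eq_or_ne b 0 with rfl | hb
  · rw [nonpos_iff_eq_zero.1 hab]
  have h1 : a / b ≤ 1 := div_le_one_of_le₀ hab zero_le
  have := hG.map_mul_le h1 b
  rw [div_mul_cancel₀ _ hb] at this
  exact this.trans (mul_le_of_le_one_left zero_le h1)

/-- A generalized inverse of `G`, up to a factor `2`. As a supremum it would be an inverse up to
continuity of `G`; the factor makes continuity unnecessary. -/
theorem exists_threshold (hG : IsOrliczFunction G) {e : ℝ} (he : 0 < e) :
    ∃ u : ℝ, 0 < u ∧ ∀ t : ℝ≥0, ((G t : ℝ) ≤ e → (t : ℝ) ≤ u) ∧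
      ((t : ℝ) ≤ u → (G (t / 2) : ℝ) ≤ e) := by
  lift e to ℝ≥0 using he.le
  have he : 0 < e := by exact_mod_cast he
  obtain ⟨a, ha⟩ := hG.nonzero
  -- By convexity `G` grows at least linearly beyond `a`.
  have hbdd : BddAbove {t | G t ≤ e} := by
    refine ⟨a * (1 + e / G a), fun t ht => ?_⟩
    by_contra hlt
    have h1 : a * (1 + e / G a) ≤ t := (not_le.1 hlt).le
    have h2 := (hG.mul_map_le (s := 1 + e / G a) (by simp) a).trans
      ((mul_comm a _ ▸ hG.monotone h1).trans ht)
    rw [add_mul, one_mul, div_mul_cancel₀ _ ha] at h2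
    exact ha (nonpos_iff_eq_zero.1 (by simpa using h2))
  refine ⟨(sSup {t | G t ≤ e} : ℝ≥0), ?_, fun t => ⟨fun ht => ?_, fun ht => ?_⟩⟩
  · have hs : e / (1 + e + G 1) ≤ 1 :=
      div_le_one_of_le₀ (by rw [add_comm 1 e, add_assoc]; exact le_self_add) zero_le
    have hmem : G (e / (1 + e + G 1) * 1) ≤ e := by
      refine (hG.map_mul_le hs 1).trans ?_
      rw [div_mul_eq_mul_div]
      refine div_le_of_le_mul₀ zero_le zero_le ?_
      gcongr
      exact le_add_self
    have hpos : 0 < e / (1 + e + G 1) * 1 := by positivity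
    exact_mod_cast hpos.trans_le (le_csSup hbdd hmem)
  · exact_mod_cast le_csSup hbdd (show t ∈ {t | G t ≤ e} by exact_mod_cast ht)
  · rcases eq_or_ne t 0 with rfl | h0
    · simp [hG.map_zero]
    have hlt : t / 2 < sSup {t | G t ≤ e} :=
      (NNReal.half_lt_self h0).trans_le (by exact_mod_cast ht)
    obtain ⟨b, hb, htb⟩ := exists_lt_of_lt_csSup ⟨0, by simp [hG.map_zero]⟩ hlt
    exact_mod_cast (hG.monotone htb.le).trans hb

/-- The generalized inverse of `Λ * G`, evaluated at `-log v`; outside of the unit interval, whose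
complement is a null set for the uniform distribution, the value only has to be positive. -/
theorem exists_scale (hG : IsOrliczFunction G) {Λ : ℝ} (hΛ : 0 < Λ) :
    ∃ U : ℝ → ℝ, (∀ v, 0 < U v) ∧ ∀ v ∈ Set.Ioo (0 : ℝ) 1, ∀ t : ℝ≥0,
      (Λ * G t ≤ -Real.log v → (t : ℝ) ≤ U v) ∧ ((t : ℝ) ≤ U v → Λ * G (t / 2) ≤ -Real.log v) := by
  have (v : ℝ) : ∃ u : ℝ, 0 < u ∧ (v ∈ Set.Ioo (0 : ℝ) 1 → ∀ t : ℝ≥0,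
      (Λ * G t ≤ -Real.log v → (t : ℝ) ≤ u) ∧
        ((t : ℝ) ≤ u → Λ * G (t / 2) ≤ -Real.log v)) := by
    by_cases hv : v ∈ Set.Ioo (0 : ℝ) 1
    · obtain ⟨u, hu, h⟩ := hG.exists_threshold (e := -Real.log v / Λ)
        (div_pos (neg_pos.2 (Real.log_neg hv.1 hv.2)) hΛ)
      simp only [le_div_iff₀' hΛ] at h
      exact ⟨u, hu, fun _ => h⟩
    · exact ⟨1, one_pos, fun h => absurd h hv⟩
  choose U hU h using this
  exact ⟨U, hU, h⟩

theorem absorbent_unitBall (hG : IsOrliczFunction G) (d : ℕ) :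
    Absorbent ℝ {y : Fin d → ℝ | ∑ i, G ‖y i‖₊ ≤ 1} := by
  refine absorbent_nhds_zero (Metric.mem_nhds_iff.2 ⟨1 / (1 + d * G 1), by positivity, ?_⟩)
  intro y hy
  have hy' : ‖y‖₊ ≤ 1 / (1 + d * G 1) := by
    rw [mem_ball_zero_iff] at hy
    exact_mod_cast hy.le
  have hle : 1 / (1 + d * G 1) ≤ (1 : ℝ≥0) := div_le_one_of_le₀ le_self_add zero_le
  calc ∑ i, G ‖y i‖₊ ≤ ∑ _i : Fin d, 1 / (1 + d * G 1) * G 1 := by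
        refine Finset.sum_le_sum fun i _ => ?_
        refine (hG.monotone ((nnnorm_le_pi_nnnorm y i).trans hy')).trans ?_
        simpa using hG.map_mul_le hle 1
    _ = d * G 1 / (1 + d * G 1) := by
        simp only [Finset.sum_const, Finset.card_univ, Fintype.card_fin, nsmul_eq_mul]
        ring
    _ ≤ 1 := div_le_one_of_le₀ le_add_self zero_le

theorem sum_le_one_of_orliczNorm_lt (hG : IsOrliczFunction G) {d : ℕ} {x : Fin d → ℝ} {a : ℝ≥0}
    (h : orliczNorm G x < a) : ∑ i, G (‖x i‖₊ / a) ≤ 1 := by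
  obtain ⟨b, hb0, hba, y, hy, rfl⟩ := exists_lt_of_gauge_lt (hG.absorbent_unitBall d) h
  refine le_trans (Finset.sum_le_sum fun i _ => hG.monotone ?_) hy
  refine div_le_of_le_mul₀ zero_le zero_le ?_
  change ‖b • y i‖₊ ≤ _
  rw [nnnorm_smul, mul_comm]
  gcongr
  rw [← NNReal.coe_le_coe, coe_nnnorm, Real.norm_of_nonneg hb0.le]
  exact hba.le

end IsOrliczFunction

theorem orliczNorm_le {G : ℝ≥0 → ℝ≥0} {d : ℕ} {x : Fin d → ℝ} {a : ℝ≥0} (ha : 0 < a)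
    (h : ∑ i, G (‖x i‖₊ / a) ≤ 1) : orliczNorm G x ≤ a := by
  refine gauge_le_of_mem a.2 ?_
  refine ⟨(a : ℝ)⁻¹ • x, ?_, smul_inv_smul₀ (by exact_mod_cast ha.ne') x⟩
  have hx (i : Fin d) : ‖((a : ℝ)⁻¹ • x) i‖₊ = ‖x i‖₊ / a := by
    rw [Pi.smul_apply, nnnorm_smul, nnnorm_inv, div_eq_inv_mul, NNReal.nnnorm_eq]
  change ∑ i, G ‖((a : ℝ)⁻¹ • x) i‖₊ ≤ 1
  simpa only [hx] using h

/-! ### Random scalings -/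

/-- The uniform distribution on the unit interval; `-log v` is then exponentially distributed. -/
noncomputable def unitMeasure : Measure ℝ := volume.restrict (Set.Ioo 0 1)

instance : IsProbabilityMeasure unitMeasure := ⟨by simp [unitMeasure]⟩

theorem unitMeasure_Ioo {y : ℝ} (hy : y ≤ 1) : unitMeasure (Set.Ioo 0 y) = ENNReal.ofReal y := by
  rw [unitMeasure, Measure.restrict_apply measurableSet_Ioo,
    Set.inter_eq_left.2 (Set.Ioo_subset_Ioo_right hy), Real.volume_Ioo, sub_zero]

theorem unitMeasure_le {y : ℝ} {S : Set ℝ} (hS : ∀ v ∈ S, v ∈ Set.Ioo (0 : ℝ) 1 → v ≤ y) :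
    unitMeasure S ≤ ENNReal.ofReal y := by
  rw [unitMeasure, Measure.restrict_apply' measurableSet_Ioo]
  refine (measure_mono (t := Set.Ioc 0 y) fun v hv => ⟨hv.2.1, hS v hv.1 hv.2⟩).trans ?_
  rw [Real.volume_Ioc, sub_zero]

/-- Independent uniform numbers for `N` repetitions and `d` coordinates. -/
noncomputable def scalingMeasure (N d : ℕ) : Measure (Fin N → Fin d → ℝ) :=
  Measure.pi fun _ => Measure.pi fun _ => unitMeasure

instance (N d : ℕ) : IsProbabilityMeasure (scalingMeasure N d) := by
  unfold scalingMeasure; infer_instance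

theorem ofReal_exp_neg_sum {d : ℕ} (a : Fin d → ℝ) :
    ∏ i, ENNReal.ofReal (Real.exp (-a i)) = ENNReal.ofReal (Real.exp (-∑ i, a i)) := by
  rw [← ENNReal.ofReal_prod_of_nonneg fun i _ => (Real.exp_pos _).le, ← Real.exp_sum,
    Finset.sum_neg_distrib]

/-- The probability that no repetition has all exponential variables above `a`. -/
theorem scalingMeasure_forall_notMem_le {N d : ℕ} {a : Fin d → ℝ} (ha : ∀ i, 0 ≤ a i) :
    scalingMeasure N d {ω | ∀ k, ω k ∉ Set.univ.pi fun i => Set.Ioo 0 (Real.exp (-a i))} ≤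
      ENNReal.ofReal ((1 - Real.exp (-∑ i, a i)) ^ N) := by
  have hset : {ω : Fin N → Fin d → ℝ |
      ∀ k, ω k ∉ Set.univ.pi fun i => Set.Ioo 0 (Real.exp (-a i))} =
      Set.univ.pi fun _ => (Set.univ.pi fun i => Set.Ioo 0 (Real.exp (-a i)))ᶜ := by
    ext ω; simp [Set.mem_pi]
  have hle : Real.exp (-∑ i, a i) ≤ 1 :=
    Real.exp_le_one_iff.2 (neg_nonpos.2 (Finset.sum_nonneg fun i _ => ha i))
  rw [hset, scalingMeasure, Measure.pi_pi, Finset.prod_const, Finset.card_univ, Fintype.card_fin,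
    prob_compl_eq_one_sub (MeasurableSet.univ_pi fun i => measurableSet_Ioo), Measure.pi_pi,
    Finset.prod_congr rfl fun i _ => unitMeasure_Ioo (Real.exp_le_one_iff.2 (neg_nonpos.2 (ha i))),
    ofReal_exp_neg_sum, ENNReal.ofReal_pow (by linarith), ENNReal.ofReal_sub _ (Real.exp_pos _).le,
    ENNReal.ofReal_one]

/-- The probability that in a fixed repetition all exponential variables are at least `a`. -/
theorem scalingMeasure_forall_le_neg_log_le {N d : ℕ} (k : Fin N) (a : Fin d → ℝ) :
    scalingMeasure N d {ω | ∀ i, ω k i ∈ Set.Ioo (0 : ℝ) 1 → a i ≤ -Real.log (ω k i)} ≤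
      ENNReal.ofReal (Real.exp (-∑ i, a i)) := by
  set T : Set (Fin d → ℝ) :=
    Set.univ.pi fun i => {v | v ∈ Set.Ioo (0 : ℝ) 1 → v ≤ Real.exp (-a i)} with hT
  have hmeas : MeasurableSet T := by
    refine MeasurableSet.univ_pi fun i => ?_
    have : {v : ℝ | v ∈ Set.Ioo (0 : ℝ) 1 → v ≤ Real.exp (-a i)} =
      (Set.Ioo 0 1)ᶜ ∪ Set.Iic (Real.exp (-a i)) := by
        ext v; simp only [Set.mem_ofPred_eq, imp_iff_not_or]; rfl
    rw [this]
    exact measurableSet_Ioo.compl.union measurableSet_Iic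
  have hsub : {ω : Fin N → Fin d → ℝ |
      ∀ i, ω k i ∈ Set.Ioo (0 : ℝ) 1 → a i ≤ -Real.log (ω k i)} ⊆ Function.eval k ⁻¹' T := by
    intro ω hω i _ hv
    rw [← Real.log_le_iff_le_exp hv.1]
    exact le_neg_of_le_neg (hω i hv)
  refine (measure_mono hsub).trans ?_
  rw [scalingMeasure, (measurePreserving_eval
    (fun _ : Fin N => Measure.pi fun _ : Fin d => unitMeasure) k).measure_preimage
      hmeas.nullMeasurableSet, hT, Measure.pi_pi, ← ofReal_exp_neg_sum]
  exact Finset.prod_le_prod' fun i _ => unitMeasure_le fun v hv => hv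

/-! ### The data structure for Orlicz norms -/

theorem IsOrliczFunction.lt_sum_of_lt_orliczNorm {G : ℝ≥0 → ℝ≥0} (hG : IsOrliczFunction G) {d : ℕ}
    {x : Fin d → ℝ} {B b r c : ℝ≥0} (hB : 1 ≤ B) (hb : 0 < b) (hr : 0 < r) (hc : b * B ≤ c)
    (h : (c * r : ℝ) < orliczNorm G x) : B < ∑ i, G (‖x i‖₊ / (b * r)) := by
  have hB0 : 0 < B := zero_lt_one.trans_le hB
  have hc0 : 0 < c := (mul_pos hb hB0).trans_le hc
  have h1 : 1 < ∑ i, G (‖x i‖₊ / (c * r)) := by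
    by_contra hle
    exact absurd h (not_lt.2 (orliczNorm_le (mul_pos hc0 hr) (not_lt.1 hle)))
  calc B = B * 1 := (mul_one B).symm
    _ < B * ∑ i, G (‖x i‖₊ / (c * r)) := by gcongr
    _ = ∑ i, B * G (‖x i‖₊ / (c * r)) := Finset.mul_sum _ _ _
    _ ≤ ∑ i, G (‖x i‖₊ / (b * r)) := by
      refine Finset.sum_le_sum fun i _ => (hG.mul_map_le hB _).trans (hG.monotone ?_)
      rw [mul_div_assoc', div_le_div_iff₀ (by positivity) (by positivity)]
      calc B * ‖x i‖₊ * (b * r) = ‖x i‖₊ * (b * B * r) := by ring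
        _ ≤ ‖x i‖₊ * (c * r) := by gcongr

/-- The data structure with its parameters left open: `N` repetitions, exponential variables of rate
`Λ`, approximation `6 * l + 2` in the maximum norm, and a far point having `B` times the weight of a
near one. The hypotheses `h1` and `h2` bound the probabilities that a near point is missed in all
repetitions, and that some far point looks near in some repetition. -/
theorem isANNDataStructure_orliczNorm_of_parameters {G : ℝ≥0 → ℝ≥0} (hG : IsOrliczFunction G)
    {d n : ℕ} (hd : 1 ≤ d) (hn : 1 ≤ n) {δ : ℝ} (hδ : 0 < δ) {l : ℕ}
    (hl : (1 / 2 : ℝ) ^ ((1 + δ) ^ l) ≤ 1 / (4 * d)) {r Λ B c : ℝ} (hr : 0 < r) (hΛ : 0 < Λ)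
    (hB : 1 ≤ B) (hc : 4 * (6 * l + 2) * B ≤ c) {N : ℕ}
    (h1 : (1 - Real.exp (-Λ)) ^ N ≤ 1 / 200) (h2 : n * N * Real.exp (-(Λ * B)) ≤ 1 / 200)
    {space time : ℝ}
    (hspace : 2 * (((4 * ⌊1 + N * (8 * d * (n : ℝ) ^ (1 + δ))⌋₊ + d + n : ℕ) : ℝ) + 1) ≤ space)
    (htime : ((12 * ⌊N * (6 * d * Real.log (2 * n + 1))⌋₊ + 7 : ℕ) : ℝ) ≤ time) :
    IsANNDataStructure queryProgram (orliczNorm G (d := d)) n r c space time := by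
  classical
  lift r to ℝ≥0 using hr.le
  have hr : 0 < r := by exact_mod_cast hr
  lift B to ℝ≥0 using zero_le_one.trans hB
  have hB : 1 ≤ B := by exact_mod_cast hB
  lift c to ℝ≥0 using le_trans (by positivity) hc
  have hc : 4 * (6 * l + 2) * B ≤ c := by exact_mod_cast hc
  intro P
  obtain ⟨U, hU0, hU⟩ := hG.exists_scale hΛ
  have hu (ω : Fin N → Fin d → ℝ) (k i) : 0 < 2 * (r : ℝ) * U (ω k i) :=
    mul_pos (mul_pos two_pos (by exact_mod_cast hr)) (hU0 _)
  choose L e hlen hq using fun ω : Fin N → Fin d → ℝ =>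
    exists_repeatedDiagram hd hn hδ hl P _ (hu ω)
  set s := 4 * ⌊1 + N * (8 * d * (n : ℝ) ^ (1 + δ))⌋₊ + d + n with hs
  set t := 12 * ⌊N * (6 * d * Real.log (2 * n + 1))⌋₊ + 7 with ht
  have hout (ω : Fin N → Fin d → ℝ) (q : Fin d → ℝ) : ∃ j : Fin n,
      outputWithin queryProgram t (diagramMemory s (L ω) (e ω)) q = some (Fin.ofNat (s + 1) j) ∧
      ((∃ k, ∀ i, |P j i - q i| ≤ (6 * l + 2) * (2 * r * U (ω k i))) ∨
        ¬ ∃ k j', ∀ i, |P j' i - q i| ≤ 2 * r * U (ω k i)) := by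
    obtain ⟨m, b, j, hm, hreach, hb, h⟩ := hq ω q
    have hlen' := Nat.le_floor (hlen ω)
    have hm' := Nat.le_floor hm
    exact ⟨j, outputWithin_diagramMemory (by omega) (by omega) hreach hb (by omega), h⟩
  refine ⟨s, t, hspace, htime, Fin N → Fin d → ℝ, inferInstance, scalingMeasure N d,
    fun ω => diagramMemory s (L ω) (e ω), inferInstance, fun ω q => ?_, fun q ⟨j0, hj0⟩ => ?_⟩
  · obtain ⟨j, hj, -⟩ := hout ω q
    rw [hj]; exact Option.some_ne_none _
  set a : Fin d → ℝ := fun i => Λ * G (‖(P j0 - q) i‖₊ / (2 * r)) with ha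
  have ha0 (i) : 0 ≤ a i := by positivity
  have hasum : ∑ i, a i ≤ Λ := by
    -- Passing from `r` to `2 * r` gives the strict inequality that the gauge needs.
    have h2r : orliczNorm G (P j0 - q) < ((2 * r : ℝ≥0) : ℝ) := by
      refine hj0.trans_lt ?_
      have : (0 : ℝ) < r := by exact_mod_cast hr
      push_cast; linarith
    have := hG.sum_le_one_of_orliczNorm_lt h2r
    rw [ha, ← Finset.mul_sum]
    refine mul_le_of_le_one_right hΛ.le ?_
    exact_mod_cast this
  set b : ℝ≥0 := 4 * (6 * l + 2) with hbdef
  set F : Finset (Fin N × Fin n) :=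
    Finset.univ.filter fun p => (c * r : ℝ) < orliczNorm G (P p.2 - q)
  have hsub : {ω : Fin N → Fin d → ℝ | ¬ ∃ (w : Fin (s + 1)) (j : Fin n),
      outputWithin queryProgram t (diagramMemory s (L ω) (e ω)) q = some w ∧ w.val = j.val ∧
        orliczNorm G (P j - q) ≤ c * r} ⊆
      {ω | ∀ k, ω k ∉ Set.univ.pi fun i => Set.Ioo 0 (Real.exp (-a i))} ∪
        ⋃ p ∈ F, {ω | ∀ i, ω p.1 i ∈ Set.Ioo (0 : ℝ) 1 →
          Λ * G (‖(P p.2 - q) i‖₊ / (b * r)) ≤ -Real.log (ω p.1 i)} := by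
    intro ω hω
    obtain ⟨j, hj, h⟩ := hout ω q
    have hfar : (c * r : ℝ) < orliczNorm G (P j - q) := by
      by_contra hle
      exact hω ⟨_, j, hj, fin_val_ofNat (by omega), not_lt.1 hle⟩
    rcases h with ⟨k, hk⟩ | hno
    · refine .inr (Set.mem_biUnion (x := (k, j))
        (Finset.mem_filter.2 ⟨Finset.mem_univ _, hfar⟩) fun i hi => ?_)
      have := (hU (ω k i) hi (‖(P j - q) i‖₊ / ((6 * l + 2) * (2 * r)))).2 ?_
      · convert this using 4
        rw [div_div]
        congr 1
        rw [hbdef]; ring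
      · push_cast
        have hr' : (0 : ℝ) < r := by exact_mod_cast hr
        rw [div_le_iff₀ (by positivity), Pi.sub_apply, Real.norm_eq_abs]
        linarith [hk i]
    · refine .inl fun k hk => hno ⟨k, j0, fun i => ?_⟩
      have hki := hk i (Set.mem_univ i)
      have hlog : a i ≤ -Real.log (ω k i) :=
        le_neg_of_le_neg ((Real.log_le_iff_le_exp hki.1).2 hki.2.le)
      have hki1 : ω k i < 1 :=
        hki.2.trans_le (Real.exp_le_one_iff.2 (neg_nonpos.2 (ha0 i)))
      have := (hU (ω k i) ⟨hki.1, hki1⟩ _).1 hlog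
      have hr' : (0 : ℝ) < r := by exact_mod_cast hr
      push_cast at this
      rw [div_le_iff₀ (by positivity), Pi.sub_apply, Real.norm_eq_abs] at this
      linarith
  have hnear : scalingMeasure N d
      {ω | ∀ k, ω k ∉ Set.univ.pi fun i => Set.Ioo 0 (Real.exp (-a i))} ≤
        ENNReal.ofReal (1 / 200) := by
    refine (scalingMeasure_forall_notMem_le ha0).trans (ENNReal.ofReal_le_ofReal (le_trans ?_ h1))
    refine pow_le_pow_left₀ (sub_nonneg.2 (Real.exp_le_one_iff.2
      (neg_nonpos.2 (Finset.sum_nonneg fun i _ => ha0 i)))) ?_ N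
    gcongr
  have hfar : scalingMeasure N d (⋃ p ∈ F, {ω | ∀ i, ω p.1 i ∈ Set.Ioo (0 : ℝ) 1 →
      Λ * G (‖(P p.2 - q) i‖₊ / (b * r)) ≤ -Real.log (ω p.1 i)}) ≤ ENNReal.ofReal (1 / 200) := by
    calc _ ≤ ∑ p ∈ F, scalingMeasure N d {ω | ∀ i, ω p.1 i ∈ Set.Ioo (0 : ℝ) 1 →
          Λ * G (‖(P p.2 - q) i‖₊ / (b * r)) ≤ -Real.log (ω p.1 i)} :=
          measure_biUnion_finset_le _ _
      _ ≤ ∑ p ∈ F, ENNReal.ofReal (Real.exp (-(Λ * B))) := by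
        refine Finset.sum_le_sum fun p hp => ?_
        refine (scalingMeasure_forall_le_neg_log_le p.1 _).trans (ENNReal.ofReal_le_ofReal ?_)
        have := hG.lt_sum_of_lt_orliczNorm hB (by positivity) hr hc (Finset.mem_filter.1 hp).2
        rw [← Finset.mul_sum]
        gcongr
        exact_mod_cast this.le
      _ ≤ ((n * N : ℕ) : ENNReal) * ENNReal.ofReal (Real.exp (-(Λ * B))) := by
        rw [Finset.sum_const, nsmul_eq_mul]
        gcongr
        refine (Finset.card_le_univ _).trans_eq ?_
        rw [Fintype.card_prod, Fintype.card_fin, Fintype.card_fin, mul_comm]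
      _ = ENNReal.ofReal (n * N * Real.exp (-(Λ * B))) := by
        rw [← ENNReal.ofReal_natCast, ← ENNReal.ofReal_mul (Nat.cast_nonneg _), Nat.cast_mul]
      _ ≤ ENNReal.ofReal (1 / 200) := ENNReal.ofReal_le_ofReal h2
  refine (measure_mono hsub).trans ((measure_union_le _ _).trans ((add_le_add hnear hfar).trans ?_))
  rw [← ENNReal.ofReal_add (by norm_num) (by norm_num)]
  norm_num [ENNReal.ofReal_div_of_pos]

/-! ### Choice of the parameters -/

theorem exp_half_le_one_add {δ : ℝ} (h0 : 0 < δ) (h1 : δ ≤ 1) : Real.exp (δ / 2) ≤ 1 + δ := by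
  rw [← Real.le_log_iff_exp_le (by linarith)]
  refine le_trans ?_ (Real.one_sub_inv_le_log_of_pos (by linarith))
  have : 1 - (1 + δ)⁻¹ = δ / (1 + δ) := by field_simp; ring
  rw [this]
  gcongr
  linarith

theorem two_hundred_le_exp_six : 200 ≤ Real.exp 6 := by
  have h : Real.exp 6 = Real.exp 1 ^ 6 := by rw [← Real.exp_nat_mul]; norm_num
  rw [h]
  calc (200 : ℝ) ≤ 2.7 ^ 6 := by norm_num
    _ ≤ Real.exp 1 ^ 6 := by
      gcongr
      linarith [Real.exp_one_gt_d9]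

theorem log_four_mul_le {d : ℕ} (hd : 1 ≤ d) :
    Real.log (4 * d) ≤ Real.exp (3 * max 1 (Real.log (Real.log d))) * Real.log 2 := by
  set M := max 1 (Real.log (Real.log d))
  have hd' : (0 : ℝ) < d := by exact_mod_cast hd
  have hx : 2.7 ≤ Real.exp M := by
    have := Real.exp_le_exp.2 (le_max_left 1 (Real.log (Real.log d)))
    linarith [Real.exp_one_gt_d9]
  have hlog : Real.log d ≤ Real.exp M := by
    rcases le_or_gt (Real.log d) 0 with h | h
    · linarith
    · exact (Real.log_le_iff_le_exp h).1 (le_max_right _ _)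
  have h2 := Real.log_two_gt_d9
  have h4 : Real.log 4 = 2 * Real.log 2 := by
    rw [← Real.log_rpow (by norm_num)]; norm_num
  have h3 : Real.exp (3 * M) = Real.exp M ^ 3 := by rw [← Real.exp_nat_mul]; norm_num
  rw [Real.log_mul (by norm_num) hd'.ne', h4, h3]
  set x := Real.exp M
  have hx3 : 2 + 2 * x ≤ x ^ 3 := by nlinarith [mul_nonneg (sub_nonneg.2 hx) (sub_nonneg.2 hx)]
  nlinarith

theorem half_rpow_one_add_pow_le {d : ℕ} (hd : 1 ≤ d) {δ : ℝ} (h0 : 0 < δ) (h1 : δ ≤ 1) {l : ℕ}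
    (hl : 6 * max 1 (Real.log (Real.log d)) / δ ≤ l) :
    (1 / 2 : ℝ) ^ ((1 + δ) ^ l) ≤ 1 / (4 * d) := by
  have hd' : (0 : ℝ) < 4 * d := by positivity
  rw [div_le_iff₀ h0] at hl
  have hpow : Real.exp (3 * max 1 (Real.log (Real.log d))) ≤ (1 + δ) ^ l := by
    refine le_trans ?_ (pow_le_pow_left₀ (Real.exp_pos _).le (exp_half_le_one_add h0 h1) l)
    rw [← Real.exp_nat_mul]
    exact Real.exp_le_exp.2 (by linarith)
  rw [one_div, one_div, Real.inv_rpow (by norm_num)]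
  refine inv_anti₀ hd' ?_
  rw [Real.rpow_def_of_pos (by norm_num), ← Real.log_le_iff_le_exp hd', mul_comm (Real.log 2)]
  exact (log_four_mul_le hd).trans (mul_le_mul_of_nonneg_right hpow (by positivity))

/-- A data structure for an Orlicz norm. With `δ = ε / 2`, the exponential variables have the rate
`1 + δ * log n`, so that a repetition keeps a near point with probability at least `n ^ (-δ) / exp 1`
and `6 * exp 1 * n ^ δ` repetitions suffice; the factor `6 / ε` between the weights of near and far
points makes the probability of keeping a far point at most `exp (-12) * n ^ (-3)`. -/
theorem isANNDataStructure_orliczNorm {ε : ℝ} (hε : 0 < ε) (hε2 : ε < 1 / 2) {d : ℕ} (hd : 1 ≤ d)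
    {G : ℝ≥0 → ℝ≥0} (hG : IsOrliczFunction G) {n : ℕ} (hn : 1 ≤ n) {r : ℝ} (hr : 0 < r) :
    IsANNDataStructure queryProgram (orliczNorm G (d := d)) n r
      (2000 * max 1 (Real.log (Real.log d)) / ε ^ 2) (2000 * d * (n : ℝ) ^ (1 + ε))
      (4000 / ε * d * (n : ℝ) ^ ε) := by
  have hn1 : (1 : ℝ) ≤ n := by exact_mod_cast hn
  have hn0 : (0 : ℝ) < n := by linarith
  have hd1 : (1 : ℝ) ≤ d := by exact_mod_cast hd
  have hlogn : 0 ≤ Real.log n := Real.log_nonneg hn1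
  set M := max 1 (Real.log (Real.log d)) with hM
  have hM1 : 1 ≤ M := le_max_left _ _
  have hε1 : 2 ≤ 1 / ε := by rw [le_div_iff₀ hε]; linarith
  have hδ : 0 < ε / 2 := by linarith
  set y := (n : ℝ) ^ (ε / 2) with hy
  have hy1 : 1 ≤ y := Real.one_le_rpow hn1 hδ.le
  have hyn : y ≤ n := by
    rw [hy]
    exact (Real.rpow_le_rpow_of_exponent_le hn1 (by linarith)).trans_eq (Real.rpow_one _)
  have hyy : y * y = (n : ℝ) ^ ε := by rw [hy, ← Real.rpow_add hn0]; congr 1; ring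
  set l := ⌈12 * M / ε⌉₊
  have hl1 : 12 * M / ε ≤ l := Nat.le_ceil _
  have hl2 : (l : ℝ) < 12 * M / ε + 1 := Nat.ceil_lt_add_one (by positivity)
  set N := ⌈6 * Real.exp 1 * y⌉₊
  have hN1 : 6 * Real.exp 1 * y ≤ N := Nat.le_ceil _
  have hN2 : (N : ℝ) ≤ 18 * y := by
    have h := Nat.ceil_lt_add_one (show 0 ≤ 6 * Real.exp 1 * y by positivity)
    have he := Real.exp_one_lt_d9
    nlinarith
  have hexp : Real.exp (-(1 + ε / 2 * Real.log n)) * (6 * Real.exp 1 * y) = 6 := by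
    have : y = Real.exp (ε / 2 * Real.log n) := by
      rw [hy, Real.rpow_def_of_pos hn0, mul_comm]
    rw [this, mul_assoc, ← Real.exp_add, mul_left_comm, ← Real.exp_add, neg_add_cancel,
      Real.exp_zero, mul_one]
  have hNE : (N : ℝ) * (8 * d * (n : ℝ) ^ (1 + ε / 2)) ≤ 144 * (d * (n : ℝ) ^ (1 + ε)) := by
    have e : (n : ℝ) ^ (1 + ε) = y * (n : ℝ) ^ (1 + ε / 2) := by
      rw [hy, ← Real.rpow_add hn0]; congr 1; ring
    rw [e]
    calc (N : ℝ) * (8 * d * (n : ℝ) ^ (1 + ε / 2))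
        ≤ 18 * y * (8 * d * (n : ℝ) ^ (1 + ε / 2)) := by gcongr
      _ = _ := by ring
  refine isANNDataStructure_orliczNorm_of_parameters hG hd hn (δ := ε / 2) (l := l)
    (Λ := 1 + ε / 2 * Real.log n) (B := 6 / ε) (N := N) hδ ?_ hr (by positivity) ?_ ?_ ?_ ?_ ?_ ?_
  · refine half_rpow_one_add_pow_le hd hδ (by linarith) (le_trans (le_of_eq ?_) hl1)
    rw [← hM]
    field_simp
    norm_num
  · rw [le_div_iff₀ hε]; linarith
  · have h1 : 8 ≤ 4 * (M / ε) := by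
      have : 1 / ε ≤ M / ε := by gcongr
      linarith
    have h2 : 6 * (l : ℝ) + 2 ≤ 76 * (M / ε) := by
      have : 12 * M / ε = 12 * (M / ε) := mul_div_assoc _ _ _
      linarith
    calc 4 * (6 * (l : ℝ) + 2) * (6 / ε) ≤ 4 * (76 * (M / ε)) * (6 / ε) := by gcongr
      _ = 1824 * M / ε ^ 2 := by field_simp; norm_num
      _ ≤ 2000 * M / ε ^ 2 := by gcongr; norm_num
  · have h0 : Real.exp (-(1 + ε / 2 * Real.log n)) ≤ 1 :=
      Real.exp_le_one_iff.2 (neg_nonpos.2 (by positivity))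
    calc _ ≤ Real.exp (-Real.exp (-(1 + ε / 2 * Real.log n))) ^ N :=
          pow_le_pow_left₀ (by linarith) (Real.one_sub_le_exp_neg _) N
      _ = Real.exp (-(Real.exp (-(1 + ε / 2 * Real.log n)) * N)) := by
          rw [← Real.exp_nat_mul]; congr 1; ring
      _ ≤ Real.exp (-6) := by
          gcongr
          rw [← hexp]
          gcongr
      _ ≤ 1 / 200 := by
          rw [Real.exp_neg, one_div]
          exact inv_anti₀ (by norm_num) two_hundred_le_exp_six
  · have hΛB : 12 + 3 * Real.log n ≤ (1 + ε / 2 * Real.log n) * (6 / ε) := by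
      have : (1 + ε / 2 * Real.log n) * (6 / ε) = 6 * (1 / ε) + 3 * Real.log n := by
        field_simp; ring
      linarith
    have hn3 : Real.exp (3 * Real.log n) = (n : ℝ) ^ 3 := by
      rw [← Real.exp_log hn0, ← Real.exp_nat_mul, Real.exp_log hn0]; norm_num
    have h12 : 40000 ≤ Real.exp 12 := by
      have : Real.exp 12 = Real.exp 6 * Real.exp 6 := by rw [← Real.exp_add]; norm_num
      nlinarith [two_hundred_le_exp_six]
    calc n * N * Real.exp (-((1 + ε / 2 * Real.log n) * (6 / ε)))
        ≤ n * (18 * n) * Real.exp (-(12 + 3 * Real.log n)) := by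
          gcongr
          exact hN2.trans (by gcongr)
      _ = 18 * n ^ 2 / (Real.exp 12 * n ^ 3) := by
          rw [Real.exp_neg, Real.exp_add, hn3]; ring
      _ ≤ 1 / 200 := by
          rw [div_le_div_iff₀ (by positivity) (by norm_num)]
          have h23 : (n : ℝ) ^ 2 ≤ n ^ 3 := pow_le_pow_right₀ hn1 (by norm_num)
          have h2 : (0 : ℝ) ≤ n ^ 3 := by positivity
          nlinarith
  · set X := (d : ℝ) * (n : ℝ) ^ (1 + ε) with hX
    have hnX : (n : ℝ) ≤ (n : ℝ) ^ (1 + ε) :=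
      (Real.rpow_one _).symm.le.trans (Real.rpow_le_rpow_of_exponent_le hn1 (by linarith))
    have hX1 : (n : ℝ) ≤ X := hnX.trans (le_mul_of_one_le_left (by positivity) hd1)
    have hX2 : (d : ℝ) ≤ X := le_mul_of_one_le_right (by positivity) (hn1.trans hnX)
    have hfl := Nat.floor_le (show 0 ≤ 1 + N * (8 * d * (n : ℝ) ^ (1 + ε / 2)) by positivity)
    rw [mul_assoc 2000, ← hX]
    push_cast
    linarith
  · have hlog : Real.log (2 * n + 1) ≤ 3 / ε * y := by
      calc Real.log (2 * n + 1) ≤ Real.log (3 * n) := Real.log_le_log (by linarith) (by linarith)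
        _ = Real.log 3 + Real.log n := Real.log_mul (by norm_num) hn0.ne'
        _ ≤ 2 + y / (ε / 2) := by
          refine add_le_add ?_ (Real.log_le_rpow_div hn0.le hδ)
          linarith [Real.log_le_sub_one_of_pos (x := 3) (by norm_num)]
        _ ≤ 1 / ε * y + 2 / ε * y := by
          refine add_le_add (by nlinarith) (le_of_eq (by field_simp))
        _ = 3 / ε * y := by ring
    have hfl := Nat.floor_le (show 0 ≤ N * (6 * d * Real.log (2 * n + 1)) from
      mul_nonneg (by positivity) (mul_nonneg (by positivity) (Real.log_nonneg (by linarith))))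
    have hlog0 : 0 ≤ Real.log (2 * n + 1) := Real.log_nonneg (by linarith)
    have hmain : N * (6 * d * Real.log (2 * n + 1)) ≤ 324 / ε * (d * (y * y)) := by
      calc N * (6 * d * Real.log (2 * n + 1)) ≤ 18 * y * (6 * d * (3 / ε * y)) := by gcongr
        _ = _ := by ring
    have hbase : 7 ≤ 7 / 2 * (1 / ε) * (d * (y * y)) := by
      have h1 : 1 ≤ d * (y * y) := one_le_mul_of_one_le_of_one_le hd1
        (one_le_mul_of_one_le_of_one_le hy1 hy1)
      nlinarith
    have hZ : 0 ≤ 1 / ε * (d * (y * y)) := by positivity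
    rw [mul_assoc (4000 / ε), ← hyy]
    push_cast
    have e1 : 324 / ε * (d * (y * y)) = 324 * (1 / ε * (d * (y * y))) := by ring
    have e2 : 4000 / ε * (d * (y * y)) = 4000 * (1 / ε * (d * (y * y))) := by ring
    rw [e2]
    linarith

/-! ### Top-`k` norms -/

theorem IsANNDataStructure.of_le_of_le_two_mul {prog : List Instr} {d n : ℕ}
    {ν ν' : (Fin d → ℝ) → ℝ} (h1 : ∀ x, ν' x ≤ ν x) (h2 : ∀ x, ν x ≤ 2 * ν' x)
    {r c space space' time : ℝ} (hspace : space ≤ space')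
    (h : IsANNDataStructure prog ν' n r c space time) :
    IsANNDataStructure prog ν n r (2 * c) space' time := by
  intro P
  obtain ⟨s, t, hs, ht, Ω, m, μ, M, hμ, hhalt, hq⟩ := h P
  refine ⟨s, t, hs.trans hspace, ht, Ω, m, μ, M, hμ, hhalt, fun q ⟨i, hi⟩ => ?_⟩
  refine (measure_mono ?_).trans (hq q ⟨i, (h1 _).trans hi⟩)
  rintro ω hω ⟨w, j, ho, hw, hj⟩
  exact hω ⟨w, j, ho, hw, (h2 _).trans (by linarith)⟩

/-- The Orlicz function `t ↦ max (t - 1 / k) 0`, whose norm is within a factor `2` of the top-`k`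
norm (truncated subtraction). -/
noncomputable def truncFunction (k : ℕ) (t : ℝ≥0) : ℝ≥0 := t - (k : ℝ≥0)⁻¹

theorem isOrliczFunction_truncFunction (k : ℕ) : IsOrliczFunction (truncFunction k) where
  convex := by
    refine ⟨convex_univ, fun x _ y _ a b _ _ hab => ?_⟩
    simp only [truncFunction, smul_eq_mul]
    rw [tsub_le_iff_right]
    calc a * x + b * y ≤ a * (x - (k : ℝ≥0)⁻¹ + (k : ℝ≥0)⁻¹) +
            b * (y - (k : ℝ≥0)⁻¹ + (k : ℝ≥0)⁻¹) := by
          gcongr <;> exact le_tsub_add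
      _ = a * (x - (k : ℝ≥0)⁻¹) + b * (y - (k : ℝ≥0)⁻¹) + (a + b) * (k : ℝ≥0)⁻¹ := by ring
      _ = _ := by rw [hab, one_mul]
  map_zero := by simp [truncFunction]
  nonzero := ⟨1 + (k : ℝ≥0)⁻¹, by simp [truncFunction]⟩

theorem topNorm_eq_coe_sum (k : ℕ) {d : ℕ} (x : Fin d → ℝ) : topNorm k x =
    ((∑ i with i.val < k, ‖x (Tuple.sort (fun j => -|x j|) i)‖₊ : ℝ≥0) : ℝ) := by
  simp [topNorm, sortedAbs]

theorem nnnorm_sort_antitone {d : ℕ} (x : Fin d → ℝ) :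
    Antitone fun i => ‖x (Tuple.sort (fun j => -|x j|) i)‖₊ := by
  intro i j hij
  have := Tuple.monotone_sort (fun j => -|x j|) hij
  simp only [Function.comp_apply, neg_le_neg_iff] at this
  rw [← NNReal.coe_le_coe]
  simpa using this

theorem topNorm_le_two_mul_orliczNorm (k : ℕ) {d : ℕ} (x : Fin d → ℝ) :
    topNorm k x ≤ 2 * orliczNorm (truncFunction k) x := by
  have h0 : 0 ≤ orliczNorm (truncFunction k) x := gauge_nonneg x
  suffices h : ∀ a, orliczNorm (truncFunction k) x < a → topNorm k x / 2 ≤ a by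
    linarith [le_of_forall_gt_imp_ge_of_dense h]
  intro a ha
  lift a to ℝ≥0 using h0.trans ha.le
  have ha0 : 0 < a := by exact_mod_cast h0.trans_lt ha
  have hsum := (isOrliczFunction_truncFunction k).sum_le_one_of_orliczNorm_lt ha
  rw [div_le_iff₀ two_pos, topNorm_eq_coe_sum]
  norm_cast
  set y := fun i => ‖x (Tuple.sort (fun j => -|x j|) i)‖₊
  rw [← Equiv.sum_comp (Tuple.sort fun j => -|x j|)] at hsum
  rw [mul_comm]
  refine (div_le_iff₀' ha0).1 ?_ |>.trans_eq (mul_comm _ _)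
  rw [Finset.sum_div]
  calc ∑ i with i.val < k, y i / a
      ≤ ∑ i with i.val < k, ((k : ℝ≥0)⁻¹ + truncFunction k (y i / a)) :=
        Finset.sum_le_sum fun i _ => by rw [add_comm]; exact le_tsub_add
    _ = (Finset.univ.filter fun i : Fin d => i.val < k).card * (k : ℝ≥0)⁻¹ +
        ∑ i with i.val < k, truncFunction k (y i / a) := by
        rw [Finset.sum_add_distrib, Finset.sum_const, nsmul_eq_mul]
    _ ≤ k * (k : ℝ≥0)⁻¹ + ∑ i, truncFunction k (y i / a) := by
        gcongr
        · exact (Fin.card_filter_val_lt (n := d) (m := k)).trans_le (min_le_right _ _)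
        · exact Finset.filter_subset _ _
    _ ≤ 1 + 1 := add_le_add mul_inv_le_one hsum
    _ = 2 := one_add_one_eq_two

theorem orliczNorm_le_topNorm {k d : ℕ} (hk : 1 ≤ k) (hkd : k ≤ d) (x : Fin d → ℝ) :
    orliczNorm (truncFunction k) x ≤ topNorm k x := by
  rw [topNorm_eq_coe_sum]
  set y := fun i => ‖x (Tuple.sort (fun j => -|x j|) i)‖₊
  refine le_of_forall_gt_imp_ge_of_dense fun a ha => ?_
  lift a to ℝ≥0 using (NNReal.coe_nonneg _).trans ha.le
  have ha : ∑ i with i.val < k, y i < a := by exact_mod_cast ha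
  have ha0 : 0 < a := zero_le.trans_lt ha
  refine orliczNorm_le ha0 ?_
  rw [← Equiv.sum_comp (Tuple.sort fun j => -|x j|),
    ← Finset.sum_filter_add_sum_filter_not _ fun i : Fin d => i.val < k]
  have hcard : (Finset.univ.filter fun i : Fin d => i.val < k).card = k := by
    rw [Fin.card_filter_val_lt, min_eq_right hkd]
  have htail : ∑ i with ¬ i.val < k, truncFunction k (y i / a) = 0 := by
    refine Finset.sum_eq_zero fun i hi => tsub_eq_zero_of_le ?_
    have hik : k ≤ i.val := not_lt.1 (Finset.mem_filter.1 hi).2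
    have h1 : k * y i ≤ a := by
      calc k * y i = ∑ j : Fin d with j.val < k, y i := by
            rw [Finset.sum_const, hcard, nsmul_eq_mul]
        _ ≤ ∑ j with j.val < k, y j := Finset.sum_le_sum fun j hj =>
            nnnorm_sort_antitone x (Fin.le_def.2 ((Finset.mem_filter.1 hj).2.le.trans hik))
        _ ≤ a := ha.le
    have hk0 : (0 : ℝ≥0) < k := by exact_mod_cast hk
    rw [div_le_iff₀ ha0, inv_mul_eq_div, le_div_iff₀ hk0, mul_comm]
    exact h1
  have hhead : ∑ i with i.val < k, truncFunction k (y i / a) ≤ 1 := by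
    calc _ ≤ ∑ i with i.val < k, y i / a := Finset.sum_le_sum fun i _ => tsub_le_self
      _ = (∑ i with i.val < k, y i) / a := (Finset.sum_div _ _ _).symm
      _ ≤ 1 := div_le_one_of_le₀ ha.le zero_le
  calc _ = ∑ i with i.val < k, truncFunction k (y i / a) +
        ∑ i with ¬ i.val < k, truncFunction k (y i / a) := rfl
    _ ≤ 1 := by rw [htail, add_zero]; exact hhead

theorem mainTheorem3 :
    (∃ (C : ℝ) (prog : List Instr), 0 < C ∧
      ∀ ε : ℝ, 0 < ε → ε < 1 / 2 → ∃ K : ℝ, 0 < K ∧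
        ∀ (d : ℕ), 1 ≤ d → ∀ (G : ℝ≥0 → ℝ≥0), IsOrliczFunction G →
          ∀ (n : ℕ), 1 ≤ n → ∀ (r : ℝ), 0 < r →
            IsANNDataStructure prog (orliczNorm G (d := d)) n r
              (C * max 1 (Real.log (Real.log d)) / ε ^ 2)
              (C * d * (n : ℝ) ^ (1 + ε))
              (K * d * (n : ℝ) ^ ε)) ∧
    (∃ (C : ℝ) (prog : List Instr), 0 < C ∧
      ∀ ε : ℝ, 0 < ε → ε < 1 / 2 → ∃ K : ℝ, 0 < K ∧
        ∀ (d k : ℕ), 1 ≤ k → k ≤ d →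
          ∀ (n : ℕ), 1 ≤ n → ∀ (r : ℝ), 0 < r →
            IsANNDataStructure prog (topNorm k (d := d)) n r
              (C * max 1 (Real.log (Real.log d)) / ε ^ 2)
              (C * d * (n : ℝ) ^ (1 + ε))
              (K * d * (n : ℝ) ^ ε)) := by
  refine ⟨⟨2000, queryProgram, by norm_num, fun ε hε hε2 => ⟨4000 / ε, by positivity,
    fun d hd G hG n hn r hr => isANNDataStructure_orliczNorm hε hε2 hd hG hn hr⟩⟩,
    ⟨4000, queryProgram, by norm_num, fun ε hε hε2 => ⟨4000 / ε, by positivity,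
    fun d k hk hkd n hn r hr => ?_⟩⟩⟩
  have hc : 4000 * max 1 (Real.log (Real.log d)) / ε ^ 2 =
      2 * (2000 * max 1 (Real.log (Real.log d)) / ε ^ 2) := by ring
  rw [hc]
  refine IsANNDataStructure.of_le_of_le_two_mul (orliczNorm_le_topNorm hk hkd)
    (topNorm_le_two_mul_orliczNorm k) ?_ (isANNDataStructure_orliczNorm hε hε2 (hk.trans hkd)
      (isOrliczFunction_truncFunction k) hn hr)
  gcongr
  norm_num
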